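/- Let $A$ be a unital $C^*$-algebra and let $X$ be a compact Hausdorff space. A Hilbert $A$-module is a right $A$-module $V$ with a positive definite $A$-valued inner product (linear in the second variable) that is complete in the norm $\|\langle v,v\rangle\|^{1/2}$; $A^n$ carries $\langle a,b\rangle=\sum a_i^*b_i$, and $V$ is finitely generated projective (f.g.p.) if $V\oplus W\cong A^n$ isometrically for some $n$ and some Hilbert $A$-module $W$. $\mathrm{Hom}_A(V,V')$ denotes the adjointable $A$-linear bounded maps with the operator norm. A Hilbert $A$-module bundle over $X$ is a space $W\to X$ with Hilbert $A$-module fibers and local trivializations $W|_U\cong U\times V$ that are inner product preserving $A$-linear isomorphisms in each fiber; it is f.g.p. if its fibers are. An isomorphism of such bundles is a homeomorphism over $X$ which is fiberwise an invertible adjointable $A$-linear map; it is isometric if it preserves the inner products. If $X$ is a smooth manifold, a smooth structure on $W$ is an atlas of local trivializations whose transition functions $U_1\cap U_2\to \mathrm{Hom}_A(V_1,V_2)$ are smooth; a fiberwise map between smooth bundles is smooth if it is given by smooth $\mathrm{Hom}_A$-valued functions in the trivializations of the atlases, and an isomorphism is smooth if it and its inverse are. A projection valued function is a continuous $\varepsilon\colon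 X\to M(n\times n,A)$ with $\varepsilon=\varepsilon^2=\varepsilon^*$ pointwise; its image is $\{(x,v): v\in\operatorname{im}\varepsilon(x)\}\subset X\times A^n$, with the restricted topology and inner product. Then: 1. Every f.g.p. Hilbert $A$-module bundle $W$ over $X$ is isometrically isomorphic to an orthogonal direct summand $P$ of some trivial bundle $X\times A^n$: the fiberwise orthogonal complement $P^\perp$ is also an f.g.p. Hilbert $A$-module bundle, and $P\oplus P^\perp= X\times A^n$ as Hilbert $A$-module bundles. 2. Every such $W$ is isometrically isomorphic to the image of a projection valued function $\varepsilon\colon X\to M(n\times n,A)$ for some $n$. 3. Conversely, the image of every projection valued function is an f.g.p. Hilbert $A$-module bundle. 4. For every projection valued function $\varepsilon_1\colon X\to M(n\times n,A)$ there is $\delta>0$ such that for every projection valued function $\varepsilon_2\colon X\to M(n\times n,A)$ with $\|\varepsilon_1(x)-\varepsilon_2(x)\|<\delta$ for all $x\in X$ the two image bundles are isomorphic, and even isometrically so. Assume in addition that $X$ is a (finite dimensional) smooth manifold. 5. (a) If the projection valued function $\varepsilon$ is smooth, its image bundle inherits a canonical smooth structure from $X\times A^n$: there is one for which the inclusion into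 $X\times A^n$ and the projection $\varepsilon$ of $X\times A^n$ onto the image are smooth, and any other smooth structure with this property is equivalent to it (the identity is smooth in both directions). (b) If the f.g.p. bundle $W$ is smooth, then $\varepsilon$ in 2 can be chosen smooth, such that $W$ is isomorphic to the image bundle with its canonical smooth structure by a smooth isometric isomorphism. 6. Every f.g.p. Hilbert $A$-module bundle over $X$ admits a smooth structure. It is unique up to isomorphism: any two smooth f.g.p. Hilbert $A$-module bundles over $X$ which are isomorphic as topological bundles are isomorphic by a smooth isometric isomorphism. -/

import Mathlib

open scoped Manifold ContDiff
open MulOpposite WithCStarModule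

universe u v w w' uE uH

/-- The opposite of a C⋆-algebra, with the order transported from `A`, is again star-ordered. -/
instance mulOppositeStarOrderedRing (A : Type u) [CStarAlgebra A] [PartialOrder A]
    [StarOrderedRing A] : StarOrderedRing Aᵐᵒᵖ :=
  StarOrderedRing.of_nonneg_iff' (fun {x y} hxy z => add_le_add_right (α := A) hxy z.unop)
    (fun x => by
      have h : (0 : Aᵐᵒᵖ) ≤ x ↔ (0 : A) ≤ x.unop := Iff.rfl
      rw [h, CStarAlgebra.nonneg_iff_eq_star_mul_self]
      constructor
      · rintro ⟨b, hb⟩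
        have h0 : (0 : A) ≤ x.unop := by rw [hb]; exact star_mul_self_nonneg b
        obtain ⟨c, hc⟩ := CStarAlgebra.nonneg_iff_eq_mul_star_self.mp h0
        exact ⟨op c, by apply unop_injective; simpa using hc⟩
      · rintro ⟨s, rfl⟩
        exact ⟨star s.unop, by simp⟩)

/-- A (right) Hilbert `A`-module over a unital C⋆-algebra `A`. The right `A`-module structure is a
module structure over `Aᵐᵒᵖ`, and Mathlib's `CStarModule` (an inner product which is linear for a
*left* action in the second variable) is used over `Aᵐᵒᵖ`; see `HilbertModule.ip` for the resulting
`A`-valued inner product. Completeness is part of the structure. -/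
structure HilbertModule (A : Type u) [CStarAlgebra A] [PartialOrder A] [StarOrderedRing A] where
  carrier : Type w
  [normedAddCommGroup : NormedAddCommGroup carrier]
  [normedSpace : NormedSpace ℂ carrier]
  [completeSpace : CompleteSpace carrier]
  [module : Module Aᵐᵒᵖ carrier]
  [isScalarTower : IsScalarTower ℂ Aᵐᵒᵖ carrier]
  [cstarModule : CStarModule Aᵐᵒᵖ carrier]

namespace HilbertModule

variable {A : Type u} [CStarAlgebra A] [PartialOrder A] [StarOrderedRing A]

instance : CoeSort (HilbertModule.{u, w} A) (Type w) := ⟨HilbertModule.carrier⟩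

attribute [instance] normedAddCommGroup normedSpace completeSpace module isScalarTower cstarModule

/-- The `A`-valued inner product `⟨v₁, v₂⟩` of a right Hilbert `A`-module. -/
def ip (V : HilbertModule.{u, w} A) (v₁ v₂ : V) : A := unop (inner Aᵐᵒᵖ v₁ v₂)

theorem ip_smul_right (V : HilbertModule.{u, w} A) (v₁ v₂ : V) (a : A) :
    V.ip v₁ (op a • v₂) = V.ip v₁ v₂ * a := by
  simp [ip]

/-- An isomorphism of Hilbert modules which preserves the inner products. -/
structure IsometricIso (V : HilbertModule.{u, w} A) (W : HilbertModule.{u, w'} A) where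
  toLinearEquiv : V ≃ₗ[Aᵐᵒᵖ] W
  ip_map : ∀ v₁ v₂ : V, W.ip (toLinearEquiv v₁) (toLinearEquiv v₂) = V.ip v₁ v₂

/-- `Hom_A(V, W)`: the continuous `A`-linear maps which have an adjoint, as a subspace of the
bounded operators with the operator norm. -/
def Hom (V : HilbertModule.{u, w} A) (W : HilbertModule.{u, w'} A) :
    Submodule ℂ (V →L[ℂ] W) where
  carrier := {T | (∀ (a : A) (v : V), T (op a • v) = op a • T v) ∧
    ∃ S : W →L[ℂ] V, ∀ (v : V) (w : W), W.ip (T v) w = V.ip v (S w)}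
  zero_mem' := ⟨by simp, 0, by simp [ip]⟩
  add_mem' := by
    rintro T₁ T₂ ⟨h₁, S₁, hS₁⟩ ⟨h₂, S₂, hS₂⟩
    refine ⟨fun a v => by simp [h₁, h₂], S₁ + S₂, fun v w => ?_⟩
    have e₁ := hS₁ v w
    have e₂ := hS₂ v w
    simp only [ip] at e₁ e₂ ⊢
    simp [e₁, e₂]
  smul_mem' := by
    rintro c T ⟨h, S, hS⟩
    refine ⟨fun a v => ?_, star c • S, fun v w => ?_⟩
    · have h1 : ∀ x : W, c • (op a • x) = op a • (c • x) := fun x => by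
        rw [← smul_assoc, ← smul_one_smul Aᵐᵒᵖ c x, ← mul_smul]
        congr 1
        simp
      simp [h, h1]
    · have e := hS v w
      simp only [ip] at e ⊢
      simp [e]

/-- The Hilbert `A`-module `Aⁿ` with inner product `∑ aᵢ* bᵢ`. The coordinates are stored in `Aᵐᵒᵖ`,
on which `Aᵐᵒᵖ` acts from the left, i.e. `A` acts from the right; see `std_ip`. -/
noncomputable abbrev std (A : Type u) [CStarAlgebra A] [PartialOrder A] [StarOrderedRing A] (n : ℕ) :
    HilbertModule.{u, u} A where
  carrier := C⋆ᵐᵒᵈ(Aᵐᵒᵖ, Fin n → Aᵐᵒᵖ)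

theorem std_ip (n : ℕ) (x y : std A n) :
    (std A n).ip x y = ∑ i, star (x i).unop * (y i).unop := by
  change unop (∑ i, (y i * star (x i))) = _
  simp

/-- The orthogonal direct sum `V ⊕ W` with inner product `⟨v₁, v₂⟩ + ⟨w₁, w₂⟩`. -/
noncomputable abbrev prod (V : HilbertModule.{u, w} A) (W : HilbertModule.{u, w'} A) :
    HilbertModule.{u, max w w'} A where
  carrier := C⋆ᵐᵒᵈ(Aᵐᵒᵖ, V × W)

/-- The element `(v, w)` of `V ⊕ W`. -/
def prodMk (V : HilbertModule.{u, w} A) (W : HilbertModule.{u, w'} A) (v : V) (w : W) :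
    V.prod W := (WithCStarModule.equiv Aᵐᵒᵖ (V × W)).symm (v, w)

theorem prod_ip (V : HilbertModule.{u, w} A) (W : HilbertModule.{u, w'} A) (v₁ v₂ : V)
    (w₁ w₂ : W) : (V.prod W).ip (V.prodMk W v₁ w₁) (V.prodMk W v₂ w₂) = V.ip v₁ v₂ + W.ip w₁ w₂ :=
  rfl

/-- The components of an element of `V ⊕ W`. -/
def prodFst (V : HilbertModule.{u, w} A) (W : HilbertModule.{u, w'} A) (z : V.prod W) : V :=
  (WithCStarModule.equiv Aᵐᵒᵖ (V × W) z).1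

/-- The components of an element of `V ⊕ W`. -/
def prodSnd (V : HilbertModule.{u, w} A) (W : HilbertModule.{u, w'} A) (z : V.prod W) : W :=
  (WithCStarModule.equiv Aᵐᵒᵖ (V × W) z).2

/-- A closed submodule of a Hilbert module, with the restricted inner product. -/
noncomputable abbrev ofClosedSubmodule (V : HilbertModule.{u, w} A) (p : ClosedSubmodule Aᵐᵒᵖ V) :
    HilbertModule.{u, w} A where
  carrier := p.toSubmodule
  completeSpace := p.isClosed'.completeSpace_coe
  cstarModule :=
    { inner := fun x y => inner Aᵐᵒᵖ (x : V) (y : V)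
      inner_add_right := CStarModule.inner_add_right
      inner_self_nonneg := CStarModule.inner_self_nonneg
      inner_self := fun {x} => by
        rw [CStarModule.inner_self]
        exact Submodule.coe_eq_zero
      inner_op_smul_right := CStarModule.inner_op_smul_right
      inner_smul_right_complex := CStarModule.inner_smul_right_complex
      star_inner := fun x y => CStarModule.star_inner (x : V) (y : V)
      norm_eq_sqrt_norm_inner_self := fun x =>
        CStarModule.norm_eq_sqrt_norm_inner_self (A := Aᵐᵒᵖ) (x : V) }

/-- The inclusion of a closed submodule. -/
def inclusion (V : HilbertModule.{u, w} A) (p : ClosedSubmodule Aᵐᵒᵖ V) :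
    V.ofClosedSubmodule p → V := fun v => (show p.toSubmodule from v).1

/-- The orthogonal complement `{v | ⟨w, v⟩ = 0 for all w ∈ p}` of a submodule. -/
def orthogonal (V : HilbertModule.{u, w} A) (p : ClosedSubmodule Aᵐᵒᵖ V) :
    ClosedSubmodule Aᵐᵒᵖ V where
  carrier := {v | ∀ w ∈ p, V.ip w v = 0}
  zero_mem' := fun w _ => by simp [ip]
  add_mem' := fun {x y} hx hy w hw => by
    have e₁ := hx w hw
    have e₂ := hy w hw
    simp only [ip] at e₁ e₂ ⊢
    simp [e₁, e₂]
  smul_mem' := fun c x hx w hw => by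
    have e := hx w hw
    simp only [ip] at e ⊢
    simp [e]
  isClosed' := by
    have h : {v : V | ∀ w ∈ p, V.ip w v = 0} = ⋂ w : V, ⋂ _ : w ∈ p, {v : V | V.ip w v = 0} := by
      ext; simp
    change IsClosed {v : V | ∀ w ∈ p, V.ip w v = 0}
    rw [h]
    refine isClosed_iInter fun w => isClosed_iInter fun _ => ?_
    refine isClosed_eq ?_ continuous_const
    exact continuous_unop.comp ((CStarModule.continuous_inner (A := Aᵐᵒᵖ) (E := V)).comp
      (show Continuous (fun v : V => ((w, v) : V × V)) by fun_prop))

/-- `V` is finitely generated projective: an orthogonal direct summand of some `Aⁿ`. -/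
def IsFGP (V : HilbertModule.{u, w} A) : Prop :=
  ∃ (n : ℕ) (W : HilbertModule.{u, u} A), Nonempty (IsometricIso (V.prod W) (std A n))

/-- The action `v ↦ M v` of an `n × n`-matrix over `A` on the column vectors `Aⁿ`. -/
noncomputable def matrixAct {n : ℕ} (M : CStarMatrix (Fin n) (Fin n) A) :
    std A n →ₗ[Aᵐᵒᵖ] std A n where
  toFun v := (WithCStarModule.equiv Aᵐᵒᵖ (Fin n → Aᵐᵒᵖ)).symm fun i =>
    op (∑ j, M i j * unop (v j))
  map_add' x y := by
    apply (WithCStarModule.equiv Aᵐᵒᵖ (Fin n → Aᵐᵒᵖ)).injective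
    funext i
    change op (∑ j, M i j * (unop _ + unop _)) = op _ + op _
    rw [← op_add, ← Finset.sum_add_distrib]
    simp only [mul_add]
  map_smul' c x := by
    apply (WithCStarModule.equiv Aᵐᵒᵖ (Fin n → Aᵐᵒᵖ)).injective
    funext i
    change op (∑ j, M i j * (unop _ * unop c)) = c * op _
    apply unop_injective
    simp only [unop_mul, unop_op, Finset.sum_mul, mul_assoc]

theorem continuous_matrixAct {n : ℕ} (M : CStarMatrix (Fin n) (Fin n) A) :
    Continuous (matrixAct M) := by
  have h : Continuous (WithCStarModule.equiv Aᵐᵒᵖ (Fin n → Aᵐᵒᵖ)) := continuous_induced_dom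
  refine continuous_induced_rng.2 (continuous_pi fun i => continuous_op.comp
    (continuous_finsetSum _ fun j _ => continuous_const.mul
      (continuous_unop.comp ((continuous_apply j).comp h))))

theorem matrixAct_mul {n : ℕ} (M N : CStarMatrix (Fin n) (Fin n) A) (v : std A n) :
    matrixAct (M * N) v = matrixAct M (matrixAct N v) := by
  apply (WithCStarModule.equiv Aᵐᵒᵖ (Fin n → Aᵐᵒᵖ)).injective
  funext i
  change op (∑ j, (M * N) i j * unop _) = op (∑ j, M i j * ∑ k, N j k * unop _)
  congr 1
  simp only [CStarMatrix.mul_apply, Finset.sum_mul, Finset.mul_sum, mul_assoc]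
  exact Finset.sum_comm

/-- The image of a projection `M ∈ M(n × n, A)` acting on `Aⁿ`. -/
noncomputable def projImage {n : ℕ} (M : CStarMatrix (Fin n) (Fin n) A) (hM : IsStarProjection M) :
    ClosedSubmodule Aᵐᵒᵖ (std A n) where
  toSubmodule := LinearMap.range (matrixAct M)
  isClosed' := by
    have h : {v | matrixAct M v = v} = Set.range (matrixAct M) := by
      ext v
      constructor
      · exact fun hv => ⟨v, hv⟩
      · rintro ⟨u, rfl⟩
        change matrixAct M (matrixAct M u) = matrixAct M u
        rw [← matrixAct_mul, hM.isIdempotentElem.eq]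
    change IsClosed (Set.range (matrixAct M))
    rw [← h]
    exact isClosed_eq (continuous_matrixAct M) continuous_id

end HilbertModule

/-- The disjoint union of a family of Hilbert modules. -/
structure FiberTotal {A : Type u} [CStarAlgebra A] [PartialOrder A] [StarOrderedRing A]
    {X : Type v} (F : X → HilbertModule.{u, w} A) where
  base : X
  vec : F base

/-- A family of Hilbert `A`-modules over `X` together with a topology on the total space. Local
triviality is not included; see `HilbertModuleFamily.IsBundle`. -/
structure HilbertModuleFamily (A : Type u) [CStarAlgebra A] [PartialOrder A] [StarOrderedRing A]
    (X : Type v) where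
  fiber : X → HilbertModule.{u, w} A
  topology : TopologicalSpace (FiberTotal fiber)

namespace HilbertModuleFamily

variable {A : Type u} [CStarAlgebra A] [PartialOrder A] [StarOrderedRing A] {X : Type v}

/-- The total space. -/
abbrev Total (W : HilbertModuleFamily.{u, v, w} A X) : Type (max v w) := FiberTotal W.fiber

instance (W : HilbertModuleFamily.{u, v, w} A X) : TopologicalSpace W.Total := W.topology

/-- The bundle projection. -/
def proj (W : HilbertModuleFamily.{u, v, w} A X) : W.Total → X := FiberTotal.base

/-- The product family `X × V`. -/
def trivial (X : Type v) [TopologicalSpace X] (V : HilbertModule.{u, w} A) :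
    HilbertModuleFamily.{u, v, w} A X where
  fiber _ := V
  topology := TopologicalSpace.induced (fun p => ((p.base, p.vec) : X × V)) inferInstance

/-- The family of closed submodules `p x ≤ W_x`, with the subspace topology. -/
noncomputable def sub (W : HilbertModuleFamily.{u, v, w} A X)
    (p : ∀ x, ClosedSubmodule Aᵐᵒᵖ (W.fiber x)) : HilbertModuleFamily.{u, v, w} A X where
  fiber x := (W.fiber x).ofClosedSubmodule (p x)
  topology := TopologicalSpace.induced
    (fun q => (⟨q.base, (W.fiber q.base).inclusion (p q.base) q.vec⟩ : W.Total)) inferInstance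

/-- The fiberwise direct sum, with the topology of the fiber product `W₁ ×_X W₂ ⊆ W₁ × W₂`. -/
noncomputable def directSum (W₁ : HilbertModuleFamily.{u, v, w} A X)
    (W₂ : HilbertModuleFamily.{u, v, w'} A X) : HilbertModuleFamily.{u, v, max w w'} A X where
  fiber x := (W₁.fiber x).prod (W₂.fiber x)
  topology := TopologicalSpace.induced
    (fun q => ((⟨q.base, (W₁.fiber q.base).prodFst (W₂.fiber q.base) q.vec⟩,
      ⟨q.base, (W₁.fiber q.base).prodSnd (W₂.fiber q.base) q.vec⟩) : W₁.Total × W₂.Total))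
    inferInstance

/-- A local trivialization `W|_U ≅ U × V` (a homeomorphism over the open set `U`), which is an
isomorphism of Hilbert `A`-modules, including the inner product, in every fiber over `U`. -/
structure LocalTrivialization [TopologicalSpace X] (W : HilbertModuleFamily.{u, v, w} A X) where
  model : HilbertModule.{u, w} A
  triv : Bundle.Trivialization model W.proj
  isometric : ∀ x ∈ triv.baseSet, ∃ f : HilbertModule.IsometricIso (W.fiber x) model,
    ∀ v : W.fiber x, (triv ⟨x, v⟩).2 = f.toLinearEquiv v

/-- The fiber coordinate of a vector in a local trivialization. -/
def LocalTrivialization.coord [TopologicalSpace X] {W : HilbertModuleFamily.{u, v, w} A X}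
    (e : W.LocalTrivialization) (x : X) (v : W.fiber x) : e.model := (e.triv ⟨x, v⟩).2

/-- `W` is locally trivial, i.e. a Hilbert `A`-module bundle. -/
def IsBundle [TopologicalSpace X] (W : HilbertModuleFamily.{u, v, w} A X) : Prop :=
  ∀ x : X, ∃ e : W.LocalTrivialization, x ∈ e.triv.baseSet

/-- `W` is a finitely generated projective Hilbert `A`-module bundle. -/
def IsFGPBundle [TopologicalSpace X] (W : HilbertModuleFamily.{u, v, w} A X) : Prop :=
  W.IsBundle ∧ ∀ x : X, (W.fiber x).IsFGP

/-- An isomorphism of Hilbert `A`-module bundles over `X`: a homeomorphism of the total spaces over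
`X` which is an adjointable `A`-linear isomorphism in each fiber. It need not preserve the inner
products. -/
structure Iso (W₁ : HilbertModuleFamily.{u, v, w} A X)
    (W₂ : HilbertModuleFamily.{u, v, w'} A X) where
  fiberEquiv : ∀ x, W₁.fiber x ≃ₗ[Aᵐᵒᵖ] W₂.fiber x
  adjointable : ∀ x, ∃ S : W₂.fiber x → W₁.fiber x, ∀ (v : W₁.fiber x) (v' : W₂.fiber x),
    (W₂.fiber x).ip (fiberEquiv x v) v' = (W₁.fiber x).ip v (S v')
  continuous_toFun :
    Continuous fun q : W₁.Total => (⟨q.base, fiberEquiv q.base q.vec⟩ : W₂.Total)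
  continuous_invFun :
    Continuous fun q : W₂.Total => (⟨q.base, (fiberEquiv q.base).symm q.vec⟩ : W₁.Total)

/-- The isomorphism preserves the `A`-valued inner products. -/
def Iso.IsIsometric {W₁ : HilbertModuleFamily.{u, v, w} A X}
    {W₂ : HilbertModuleFamily.{u, v, w'} A X} (Φ : Iso W₁ W₂) : Prop :=
  ∀ (x : X) (v v' : W₁.fiber x),
    (W₂.fiber x).ip (Φ.fiberEquiv x v) (Φ.fiberEquiv x v') = (W₁.fiber x).ip v v'

/-- The closed submodules `p x ≤ T_x` and their orthogonal complements form finitely generated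
projective Hilbert `A`-module bundles `P` and `P^⊥` such that `P ⊕ P^⊥ = T`: addition is an
inner product preserving isomorphism of bundles. -/
def IsOrthogonalSummand [TopologicalSpace X] (T : HilbertModuleFamily.{u, v, w} A X)
    (p : ∀ x, ClosedSubmodule Aᵐᵒᵖ (T.fiber x)) : Prop :=
  (T.sub p).IsFGPBundle ∧ (T.sub fun x => (T.fiber x).orthogonal (p x)).IsFGPBundle ∧
  ∃ Ψ : Iso ((T.sub p).directSum (T.sub fun x => (T.fiber x).orthogonal (p x))) T,
    Ψ.IsIsometric ∧
    ∀ (x : X) (v : (T.fiber x).ofClosedSubmodule (p x))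
      (v' : (T.fiber x).ofClosedSubmodule ((T.fiber x).orthogonal (p x))),
      Ψ.fiberEquiv x (HilbertModule.prodMk _ _ v v') =
        (T.fiber x).inclusion _ v + (T.fiber x).inclusion _ v'

section Smooth

variable {E : Type*} [NormedAddCommGroup E] [NormedSpace ℝ E] {H : Type*} [TopologicalSpace H]
  (I : ModelWithCorners ℝ E H) [TopologicalSpace X] [ChartedSpace H X]

/-- In the local trivializations `e₁` and `e₂`, the fiberwise maps `f x` are given by a smooth
function with values in the normed space `Hom_A(V₁, V₂)` (on the common domain). -/
def SmoothInCoords {W₁ : HilbertModuleFamily.{u, v, w} A X}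
    {W₂ : HilbertModuleFamily.{u, v, w'} A X}
    (e₁ : W₁.LocalTrivialization) (e₂ : W₂.LocalTrivialization)
    (f : ∀ x, W₁.fiber x → W₂.fiber x) : Prop :=
  ∃ g : X → HilbertModule.Hom e₁.model e₂.model,
    ContMDiffOn I 𝓘(ℝ, HilbertModule.Hom e₁.model e₂.model) ∞ g
      (e₁.triv.baseSet ∩ e₂.triv.baseSet) ∧
    ∀ x ∈ e₁.triv.baseSet ∩ e₂.triv.baseSet, ∀ v : W₁.fiber x,
      (g x : e₁.model →L[ℂ] e₂.model) (e₁.coord x v) = e₂.coord x (f x v)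

/-- A smooth structure: an atlas of local trivializations with smooth transition functions. -/
structure SmoothStructure (W : HilbertModuleFamily.{u, v, w} A X) where
  atlas : Set W.LocalTrivialization
  exists_mem : ∀ x : X, ∃ e ∈ atlas, x ∈ e.triv.baseSet
  smooth_transition : ∀ e₁ ∈ atlas, ∀ e₂ ∈ atlas, SmoothInCoords I e₁ e₂ fun _ v => v

variable {I}

/-- A fiberwise map between smooth bundles is smooth. -/
def IsSmoothMap {W₁ : HilbertModuleFamily.{u, v, w} A X}
    {W₂ : HilbertModuleFamily.{u, v, w'} A X}
    (S₁ : SmoothStructure I W₁) (S₂ : SmoothStructure I W₂)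
    (f : ∀ x, W₁.fiber x → W₂.fiber x) : Prop :=
  ∀ e₁ ∈ S₁.atlas, ∀ e₂ ∈ S₂.atlas, SmoothInCoords I e₁ e₂ f

/-- The isomorphism and its inverse are smooth. -/
def Iso.IsSmooth {W₁ : HilbertModuleFamily.{u, v, w} A X}
    {W₂ : HilbertModuleFamily.{u, v, w'} A X} (Φ : Iso W₁ W₂)
    (S₁ : SmoothStructure I W₁) (S₂ : SmoothStructure I W₂) : Prop :=
  IsSmoothMap S₁ S₂ (fun x => Φ.fiberEquiv x) ∧
    IsSmoothMap S₂ S₁ (fun x => (Φ.fiberEquiv x).symm)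

/-- Two smooth structures on `W` define the same smooth bundle: the identity is smooth. -/
def SmoothStructure.Equivalent {W : HilbertModuleFamily.{u, v, w} A X}
    (S₁ S₂ : SmoothStructure I W) : Prop :=
  IsSmoothMap S₁ S₂ (fun _ v => v) ∧ IsSmoothMap S₂ S₁ (fun _ v => v)

end Smooth

/-- The global trivialization of the product family. -/
def trivialChart (X : Type v) [TopologicalSpace X] (V : HilbertModule.{u, w} A) :
    (trivial X V).LocalTrivialization where
  model := V
  triv :=
    { toFun := fun p => (p.base, p.vec)
      invFun := fun q => ⟨q.1, q.2⟩
      source := Set.univ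
      target := Set.univ
      map_source' := fun _ _ => Set.mem_univ _
      map_target' := fun _ _ => Set.mem_univ _
      left_inv' := fun _ _ => rfl
      right_inv' := fun _ _ => rfl
      open_source := isOpen_univ
      open_target := isOpen_univ
      continuousOn_toFun := (continuous_induced_dom).continuousOn
      continuousOn_invFun := (continuous_induced_rng.2 (show Continuous fun q : X × V => (q.1, q.2) from
        continuous_id)).continuousOn
      baseSet := Set.univ
      open_baseSet := isOpen_univ
      source_eq := rfl
      target_eq := by simp
      proj_toFun := fun _ _ => rfl }
  isometric := fun _ _ => ⟨⟨LinearEquiv.refl Aᵐᵒᵖ V, fun _ _ => rfl⟩, fun _ => rfl⟩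

/-- The product smooth structure on `X × V`. -/
def trivialSmooth {E : Type*} [NormedAddCommGroup E] [NormedSpace ℝ E] {H : Type*}
    [TopologicalSpace H] (I : ModelWithCorners ℝ E H) (X : Type v) [TopologicalSpace X]
    [ChartedSpace H X] (V : HilbertModule.{u, w} A) : SmoothStructure I (trivial X V) where
  atlas := {trivialChart X V}
  exists_mem := fun x => ⟨_, rfl, Set.mem_univ x⟩
  smooth_transition := by
    rintro _ rfl _ rfl
    refine ⟨fun _ => ⟨ContinuousLinearMap.id ℂ V, fun _ _ => rfl, ContinuousLinearMap.id ℂ V,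
      fun _ _ => rfl⟩, contMDiffOn_const, fun _ _ _ => rfl⟩

end HilbertModuleFamily

/-- A continuous function `X → M(n × n, A)` whose values are projections, `ε = ε² = ε*`. -/
structure ProjectionFunction (A : Type u) [CStarAlgebra A] [PartialOrder A] [StarOrderedRing A]
    (X : Type v) [TopologicalSpace X] (n : ℕ) where
  toFun : X → CStarMatrix (Fin n) (Fin n) A
  continuous_toFun : Continuous toFun
  isStarProjection : ∀ x, IsStarProjection (toFun x)

namespace ProjectionFunction

open HilbertModuleFamily

variable {A : Type u} [CStarAlgebra A] [PartialOrder A] [StarOrderedRing A] {X : Type v}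
  [TopologicalSpace X] {n : ℕ}

/-- The trivial bundle `X × Aⁿ`. -/
noncomputable abbrev ambient (A : Type u) [CStarAlgebra A] [PartialOrder A] [StarOrderedRing A]
    (X : Type v) [TopologicalSpace X] (n : ℕ) : HilbertModuleFamily.{u, v, u} A X :=
  HilbertModuleFamily.trivial X (HilbertModule.std A n)

/-- The fiberwise image `{(x, v) | v ∈ im ε(x)} ⊆ X × Aⁿ`. -/
noncomputable def image (ε : ProjectionFunction A X n) : HilbertModuleFamily.{u, v, u} A X :=
  (ambient A X n).sub fun x => HilbertModule.projImage (ε.toFun x) (ε.isStarProjection x)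

/-- The inclusion of the image family into `X × Aⁿ`. -/
noncomputable def incl (ε : ProjectionFunction A X n) (x : X) :
    ε.image.fiber x → (ambient A X n).fiber x :=
  (HilbertModule.std A n).inclusion
    (HilbertModule.projImage (ε.toFun x) (ε.isStarProjection x))

/-- The map `v ↦ ε(x) v` from `X × Aⁿ` onto the image family. -/
noncomputable def toImage (ε : ProjectionFunction A X n) (x : X) :
    (ambient A X n).fiber x → ε.image.fiber x :=
  fun v => (⟨HilbertModule.matrixAct (ε.toFun x) v, v, rfl⟩ :
    LinearMap.range (HilbertModule.matrixAct (ε.toFun x)))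

variable {E : Type*} [NormedAddCommGroup E] [NormedSpace ℝ E] {H : Type*} [TopologicalSpace H]
  {I : ModelWithCorners ℝ E H} [ChartedSpace H X]

/-- The smooth structure on the image family is inherited from `X × Aⁿ`: the inclusion into
`X × Aⁿ` and the projection `ε` from `X × Aⁿ` are smooth. -/
def IsInherited (ε : ProjectionFunction A X n) (S : SmoothStructure I ε.image) : Prop :=
  IsSmoothMap S (trivialSmooth I X (HilbertModule.std A n)) ε.incl ∧
    IsSmoothMap (trivialSmooth I X (HilbertModule.std A n)) S ε.toImage

end ProjectionFunction

section InverseSquareRoot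

open Filter Topology

variable {B : Type*} [CStarAlgebra B]

/-- The inverse square root of a positive invertible element, by functional calculus. -/
noncomputable def invSqrt (b : B) : B := cfc (fun t : ℝ => (√t)⁻¹) b

theorem isSelfAdjoint_invSqrt (b : B) : IsSelfAdjoint (invSqrt b) := cfc_predicate _ _

theorem continuousOn_inv_sqrt : ContinuousOn (fun t : ℝ => (√t)⁻¹) (Set.Ioi 0) :=
  Real.continuous_sqrt.continuousOn.inv₀ fun _ ht => (Real.sqrt_pos.2 ht).ne'

theorem invSqrt_mul_self_mul {b : B} (hb : IsSelfAdjoint b) (hs : ∀ t ∈ spectrum ℝ b, 0 < t) :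
    invSqrt b * invSqrt b * b = 1 := by
  have hc : ContinuousOn (fun t : ℝ => (√t)⁻¹) (spectrum ℝ b) := continuousOn_inv_sqrt.mono hs
  have h : cfc (fun t : ℝ => (√t)⁻¹ * (√t)⁻¹ * t) b = 1 := by
    rw [← cfc_one ℝ b]
    refine cfc_congr fun t ht => ?_
    have h0 := hs t ht
    simp only [← mul_inv, Real.mul_self_sqrt h0.le, Pi.one_apply]
    exact inv_mul_cancel₀ h0.ne'
  rw [cfc_mul (fun t : ℝ => (√t)⁻¹ * (√t)⁻¹) (fun t => t) b (hc.mul hc) continuousOn_id,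
    cfc_mul _ _ b hc hc, cfc_id' ℝ b] at h
  exact h

theorem commute_invSqrt {b c : B} (h : Commute b c) : Commute (invSqrt b) c := h.cfc_real _

theorem continuousOn_invSqrt {X : Type*} [TopologicalSpace X] {b : X → B} {s : Set X}
    (hb : ContinuousOn b s) (hsa : ∀ x ∈ s, IsSelfAdjoint (b x))
    (hs : ∀ x ∈ s, ∀ t ∈ spectrum ℝ (b x), 0 < t) :
    ContinuousOn (fun x => invSqrt (b x)) s := by
  refine ContinuousOn.cfc_of_mem_nhdsSet (s := Set.Ioi 0) _ ?_ hb hsa continuousOn_inv_sqrt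
  rw [isOpen_Ioi.mem_nhdsSet]
  exact Set.iUnion₂_subset hs

theorem abs_sub_one_le_of_mem_spectrum {b : B} {t : ℝ} (ht : t ∈ spectrum ℝ b) :
    |t - 1| ≤ ‖b - 1‖ := by
  rcases subsingleton_or_nontrivial B with h | h
  · simp [spectrum.of_subsingleton] at ht
  have h1 : t - 1 ∈ spectrum ℝ (b - 1) := by
    have := spectrum.sub_singleton_eq (R := ℝ) b 1
    rw [map_one] at this
    rw [← this]
    exact Set.sub_mem_sub ht rfl
  simpa using spectrum.norm_le_norm_of_mem h1

theorem norm_invSqrt_sub_one_le {b : B} (hb : IsSelfAdjoint b) (h : ‖b - 1‖ ≤ 3 / 4) :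
    ‖invSqrt b - 1‖ ≤ 2 * ‖b - 1‖ := by
  have hpos : ∀ t ∈ spectrum ℝ b, 1 / 4 ≤ t := fun t ht => by
    have := (abs_le.1 ((abs_sub_one_le_of_mem_spectrum ht).trans h)).1
    linarith
  have hc : ContinuousOn (fun t : ℝ => (√t)⁻¹) (spectrum ℝ b) :=
    continuousOn_inv_sqrt.mono fun t ht => by
      have := hpos t ht
      simp only [Set.mem_Ioi]
      linarith
  have e : invSqrt b - 1 = cfc (fun t : ℝ => (√t)⁻¹ - 1) b := by
    rw [cfc_sub _ _ b hc continuousOn_const, cfc_const_one ℝ b]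
    rfl
  rw [e]
  refine norm_cfc_le (by positivity) fun t ht => ?_
  refine le_trans ?_ (mul_le_mul_of_nonneg_left (abs_sub_one_le_of_mem_spectrum ht) zero_le_two)
  have h4 := hpos t ht
  have hs : 1 / 2 ≤ √t := Real.le_sqrt_of_sq_le (by norm_num; linarith)
  have h0 : 0 < √t := by linarith
  have ht2 : t = √t * √t := (Real.mul_self_sqrt (by linarith)).symm
  have e1 : (√t)⁻¹ - 1 = (1 - √t) / √t := by field_simp
  have e2 : t - 1 = (√t - 1) * (√t + 1) := by linear_combination ht2
  rw [Real.norm_eq_abs, e1, abs_div, abs_of_pos h0, div_le_iff₀ h0, e2, abs_mul, abs_sub_comm,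
    abs_of_pos (by linarith : 0 < √t + 1)]
  have := abs_nonneg (√t - 1)
  nlinarith

theorem spectrum_pos_of_norm_sub_one_lt {b : B} (h : ‖b - 1‖ < 1) :
    ∀ t ∈ spectrum ℝ b, 0 < t := fun t ht => by
  have := (abs_lt.1 ((abs_sub_one_le_of_mem_spectrum ht).trans_lt h)).1
  linarith

theorem exists_smooth_invSqrt (B : Type*) [CStarAlgebra B] :
    ∃ δ > 0, ∃ r : B → B, ContDiffOn ℝ ∞ r (Metric.ball 1 δ) ∧
      ∀ b ∈ Metric.ball (1 : B) δ, IsSelfAdjoint b → r b = invSqrt b := by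
  have hsq : ContDiff ℝ ω (fun y : B => y * y) := contDiff_id.mul contDiff_id
  have hd : HasFDerivAt (fun y : B => y * y)
      ((ContinuousLinearEquiv.smulLeft (Units.mk0 (2 : ℝ) two_ne_zero) : B ≃L[ℝ] B) : B →L[ℝ] B)
      1 := by
    have := (hasFDerivAt_id (𝕜 := ℝ) (1 : B)).mul' (hasFDerivAt_id (1 : B))
    refine this.congr_fderiv ?_
    ext y
    simp [Units.smul_def, two_smul]
  have hω : (ω : WithTop ℕ∞) ≠ 0 := by simp
  set ψ : B → B := hsq.contDiffAt.localInverse hd hω with hψ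
  have hψd : ContDiffAt ℝ ω ψ 1 := by
    have := hsq.contDiffAt.to_localInverse hd hω
    rwa [one_mul] at this
  have hψi : ∀ᶠ y in 𝓝 (1 : B), ψ (y * y) = y :=
    (hsq.contDiffAt.hasStrictFDerivAt' hd hω).eventually_left_inverse
  have hr : ContDiffAt ℝ ω (fun b : B => ψ (Ring.inverse b)) 1 := by
    have h1 : ContDiffAt ℝ ω (Ring.inverse : B → B) 1 := contDiffAt_ringInverse ℝ (1 : Bˣ)
    refine ContDiffAt.comp 1 ?_ h1
    rwa [Ring.inverse_one]
  have hr' : ∀ᶠ b in 𝓝 (1 : B), ContDiffAt ℝ ω (fun b : B => ψ (Ring.inverse b)) b :=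
    hr.eventually (by simp)
  obtain ⟨η, hη, hη'⟩ := Metric.eventually_nhds_iff.1 hψi
  obtain ⟨θ, hθ, hθ'⟩ := Metric.eventually_nhds_iff.1 hr'
  refine ⟨min θ (min (η / 2) (3 / 4)), by positivity, fun b => ψ (Ring.inverse b), ?_, ?_⟩
  · intro b hb
    rw [Metric.mem_ball, lt_min_iff] at hb
    exact ((hθ' hb.1).of_le (by exact le_top)).contDiffWithinAt
  · intro b hb hsa
    rw [Metric.mem_ball, lt_min_iff, lt_min_iff, dist_eq_norm] at hb
    have hn := norm_invSqrt_sub_one_le hsa hb.2.2.le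
    have hm := invSqrt_mul_self_mul hsa
      (spectrum_pos_of_norm_sub_one_lt (hb.2.2.trans (by norm_num)))
    have hu : IsUnit b := by
      have := isUnit_one_sub_of_norm_lt_one (x := 1 - b)
        (by rw [norm_sub_rev]; exact hb.2.2.trans (by norm_num))
      rwa [sub_sub_cancel] at this
    have hi : Ring.inverse b = invSqrt b * invSqrt b := by
      obtain ⟨c, rfl⟩ := hu
      rw [Ring.inverse_unit]
      exact (Units.eq_inv_of_mul_eq_one_right hm).symm
    change ψ (Ring.inverse b) = _
    rw [hi]
    apply hη'
    rw [dist_eq_norm]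
    linarith [hb.2.1]

/-- A radius on which the inverse square root is given by a smooth function. -/
noncomputable def sqrtRadius (B : Type*) [CStarAlgebra B] : ℝ :=
  min 1 (exists_smooth_invSqrt B).choose

theorem sqrtRadius_pos (B : Type*) [CStarAlgebra B] : 0 < sqrtRadius B :=
  lt_min one_pos (exists_smooth_invSqrt B).choose_spec.1

theorem sqrtRadius_le_one (B : Type*) [CStarAlgebra B] : sqrtRadius B ≤ 1 := min_le_left _ _

variable {E : Type*} [NormedAddCommGroup E] [NormedSpace ℝ E] {H : Type*} [TopologicalSpace H]
  {I : ModelWithCorners ℝ E H} {X : Type*} [TopologicalSpace X] [ChartedSpace H X]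

theorem contMDiffOn_invSqrt {b : X → B} {s : Set X} (hb : ContMDiffOn I 𝓘(ℝ, B) ∞ b s)
    (hsa : ∀ x ∈ s, IsSelfAdjoint (b x)) (h : ∀ x ∈ s, ‖b x - 1‖ < sqrtRadius B) :
    ContMDiffOn I 𝓘(ℝ, B) ∞ (fun x => invSqrt (b x)) s := by
  obtain ⟨r, hr, hri⟩ := (exists_smooth_invSqrt B).choose_spec.2
  have hm : ∀ x ∈ s, b x ∈ Metric.ball (1 : B) (exists_smooth_invSqrt B).choose := fun x hx => by
    rw [Metric.mem_ball, dist_eq_norm]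
    exact (h x hx).trans_le (min_le_right _ _)
  exact (hr.contMDiffOn.comp hb hm).congr fun x hx => (hri _ (hm x hx) (hsa x hx)).symm

end InverseSquareRoot

section PolarDecomposition

variable {B : Type*} [CStarAlgebra B]

/-- The partial isometry in the polar decomposition of `z`, for `z` invertible as a map out of the
range of the projection `p`. -/
noncomputable def polar (z p : B) : B := z * invSqrt (star z * z + (1 - p))

theorem isSelfAdjoint_star_mul_self_add {z p : B} (hp : IsSelfAdjoint p) :
    IsSelfAdjoint (star z * z + (1 - p)) :=
  (IsSelfAdjoint.star_mul_self z).add ((IsSelfAdjoint.one B).sub hp)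

theorem spectrum_star_mul_self_add_pos {z p : B} (hp : IsStarProjection p)
    (h : IsUnit (star z * z + (1 - p))) : ∀ t ∈ spectrum ℝ (star z * z + (1 - p)), 0 < t := by
  let _ := CStarAlgebra.spectralOrder B
  let _ := CStarAlgebra.spectralOrderedRing B
  intro t ht
  have h0 : 0 ≤ star z * z + (1 - p) := add_nonneg (star_mul_self_nonneg z) hp.one_sub_nonneg
  refine (spectrum_nonneg_of_nonneg h0 ht).lt_of_ne fun h' => ?_
  rw [← h'] at ht
  exact (spectrum.zero_mem_iff ℝ).1 ht h

/-- A partial isometry absorbs its initial and final projections. -/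
theorem mul_initial_of_star_mul_self {U p : B} (hp : IsStarProjection p) (h : star U * U = p) :
    U * p = U := by
  rw [← sub_eq_zero, ← CStarRing.star_mul_self_eq_zero_iff]
  have e : star (U * p - U) * (U * p - U) =
      star p * (star U * U) * p - star p * (star U * U) - (star U * U) * p + star U * U := by
    rw [star_sub, star_mul]
    noncomm_ring
  rw [e, h, hp.isSelfAdjoint.star_eq, hp.isIdempotentElem.eq, hp.isIdempotentElem.eq]
  simp

theorem final_mul_of_mul_star_self {U q : B} (hq : IsStarProjection q) (h : U * star U = q) :
    q * U = U := by
  have := mul_initial_of_star_mul_self (U := star U) hq (by rw [star_star, h])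
  apply star_injective
  rw [star_mul, hq.isSelfAdjoint.star_eq, this]

theorem polar_spec {z p q : B} (hp : IsStarProjection p) (hq : IsStarProjection q)
    (hzp : z * p = z) (hqz : q * z = z) (h₁ : IsUnit (star z * z + (1 - p)))
    (h₂ : IsUnit (z * star z + (1 - q))) :
    star (polar z p) * polar z p = p ∧ polar z p * star (polar z p) = q := by
  set b := star z * z + (1 - p) with hb
  have hbs : IsSelfAdjoint b := isSelfAdjoint_star_mul_self_add hp.isSelfAdjoint
  have hR := invSqrt_mul_self_mul hbs (spectrum_star_mul_self_add_pos hp h₁)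
  have hpp := hp.isIdempotentElem.eq
  have hps := hp.isSelfAdjoint.star_eq
  have hpz : p * star z = star z := by
    apply star_injective
    rw [star_mul, star_star, hps, hzp]
  have hzq : star z * q = star z := by
    apply star_injective
    rw [star_mul, star_star, hq.isSelfAdjoint.star_eq, hqz]
  have hbp : b * p = star z * z := by
    rw [hb, add_mul, mul_assoc, hzp, sub_mul, one_mul, hpp, sub_self, add_zero]
  have hpb : p * b = star z * z := by
    rw [hb, mul_add, ← mul_assoc, hpz, mul_sub, mul_one, hpp, sub_self, add_zero]
  have hcp : Commute (invSqrt b) p := commute_invSqrt (hbp.trans hpb.symm)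
  have hcb : Commute (invSqrt b) b := commute_invSqrt (Commute.refl b)
  set R := invSqrt b with hRd
  have hRs : star R = R := (isSelfAdjoint_invSqrt b).star_eq
  have hU : polar z p = z * R := rfl
  have hRbR : R * b * R = 1 := by
    rw [mul_assoc, ← hcb.eq, ← mul_assoc, hR]
  have h1 : star (z * R) * (z * R) = p := by
    calc star (z * R) * (z * R) = R * (star z * z) * R := by
          rw [star_mul, hRs]; noncomm_ring
      _ = R * b * (p * R) := by rw [← hbp]; noncomm_ring
      _ = R * b * R * p := by rw [← hcp.eq]; noncomm_ring
      _ = p := by rw [hRbR, one_mul]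
  refine ⟨h1, ?_⟩
  rw [hU]
  set f := z * R * star (z * R) with hf
  have hf' : f = z * R * R * star z := by rw [hf, star_mul, hRs]; noncomm_ring
  have hfz : f * z = z := by
    calc f * z = z * (R * R) * (star z * z) := by rw [hf']; noncomm_ring
      _ = z * (R * R * b) * p := by rw [← hbp]; noncomm_ring
      _ = z := by rw [hR, mul_one, hzp]
  have hfq : f * q = f := by rw [hf', mul_assoc, hzq]
  have h0 : (q - f) * (z * star z + (1 - q)) = 0 := by
    have e : (q - f) * (z * star z + (1 - q)) =
      (q * z - f * z) * star z + (q - q * q) - (f - f * q) := by noncomm_ring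
    rw [e, hqz, hfz, hfq, hq.isIdempotentElem.eq]
    simp
  have := (h₂.mul_left_eq_zero).1 h0
  exact (sub_eq_zero.1 this).symm

theorem isUnit_add_one_sub {a p : B} (h : ‖a - p‖ < 1) : IsUnit (a + (1 - p)) := by
  have := isUnit_one_sub_of_norm_lt_one (x := p - a) (by rwa [norm_sub_rev])
  convert this using 1
  abel

theorem polar_spec_of_norm_lt {z p q : B} (hp : IsStarProjection p) (hq : IsStarProjection q)
    (hzp : z * p = z) (hqz : q * z = z) (h₁ : ‖star z * z - p‖ < 1) (h₂ : ‖z * star z - q‖ < 1) :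
    star (polar z p) * polar z p = p ∧ polar z p * star (polar z p) = q :=
  polar_spec hp hq hzp hqz (isUnit_add_one_sub h₁) (isUnit_add_one_sub h₂)

theorem continuousOn_polar {X : Type*} [TopologicalSpace X] {z p : X → B} {s : Set X}
    (hz : ContinuousOn z s) (hpc : ContinuousOn p s) (hp : ∀ x ∈ s, IsStarProjection (p x))
    (h : ∀ x ∈ s, IsUnit (star (z x) * z x + (1 - p x))) :
    ContinuousOn (fun x => polar (z x) (p x)) s := by
  refine hz.mul (continuousOn_invSqrt ((hz.star.mul hz).add (continuousOn_const.sub hpc))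
    (fun x hx => isSelfAdjoint_star_mul_self_add (hp x hx).isSelfAdjoint)
    fun x hx => spectrum_star_mul_self_add_pos (hp x hx) (h x hx))

/-- A partial isometry from the range of `p` onto the range of `q`, if `p` and `q` are close. -/
noncomputable def align (p q : B) : B := polar (q * p) p

theorem norm_star_mul_self_sub_le {p q : B} (hp : IsStarProjection p) (hq : IsStarProjection q) :
    ‖star (q * p) * (q * p) - p‖ ≤ ‖p - q‖ := by
  have e : star (q * p) * (q * p) - p = p * (q - p) * p := by
    have h1 := hp.isIdempotentElem.eq
    have h2 := hq.isIdempotentElem.eq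
    rw [star_mul, hp.isSelfAdjoint.star_eq, hq.isSelfAdjoint.star_eq]
    calc p * q * (q * p) - p = p * (q * q) * p - p := by noncomm_ring
      _ = p * q * p - p * p * p := by rw [h2, h1, h1]
      _ = _ := by noncomm_ring
  rw [e]
  calc ‖p * (q - p) * p‖ ≤ ‖p‖ * ‖q - p‖ * ‖p‖ := norm_mul₃_le
    _ ≤ 1 * ‖q - p‖ * 1 := by gcongr <;> exact hp.norm_le
    _ = ‖p - q‖ := by rw [one_mul, mul_one, norm_sub_rev]

theorem norm_mul_star_self_sub_le {p q : B} (hp : IsStarProjection p) (hq : IsStarProjection q) :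
    ‖q * p * star (q * p) - q‖ ≤ ‖p - q‖ := by
  have := norm_star_mul_self_sub_le hq hp
  rw [star_mul, hp.isSelfAdjoint.star_eq, hq.isSelfAdjoint.star_eq] at this ⊢
  rwa [norm_sub_rev p q]

theorem align_spec {p q : B} (hp : IsStarProjection p) (hq : IsStarProjection q)
    (h : ‖p - q‖ < 1) :
    star (align p q) * align p q = p ∧ align p q * star (align p q) = q :=
  polar_spec_of_norm_lt hp hq (by rw [mul_assoc, hp.isIdempotentElem.eq])
    (by rw [← mul_assoc, hq.isIdempotentElem.eq])
    ((norm_star_mul_self_sub_le hp hq).trans_lt h) ((norm_mul_star_self_sub_le hp hq).trans_lt h)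

theorem continuousOn_align {X : Type*} [TopologicalSpace X] {p q : X → B} {s : Set X}
    (hpc : ContinuousOn p s) (hqc : ContinuousOn q s) (hp : ∀ x ∈ s, IsStarProjection (p x))
    (hq : ∀ x ∈ s, IsStarProjection (q x)) (h : ∀ x ∈ s, ‖p x - q x‖ < 1) :
    ContinuousOn (fun x => align (p x) (q x)) s :=
  continuousOn_polar (hqc.mul hpc) hpc hp fun x hx => isUnit_add_one_sub
    ((norm_star_mul_self_sub_le (hp x hx) (hq x hx)).trans_lt (h x hx))

variable {E : Type*} [NormedAddCommGroup E] [NormedSpace ℝ E] {H : Type*} [TopologicalSpace H]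
  {I : ModelWithCorners ℝ E H} {X : Type*} [TopologicalSpace X] [ChartedSpace H X]

theorem contMDiffOn_mul' {f g : X → B} {s : Set X} (hf : ContMDiffOn I 𝓘(ℝ, B) ∞ f s)
    (hg : ContMDiffOn I 𝓘(ℝ, B) ∞ g s) : ContMDiffOn I 𝓘(ℝ, B) ∞ (fun x => f x * g x) s :=
  (contDiff_mul (𝕜 := ℝ) (𝔸 := B)).contMDiff.comp_contMDiffOn (hf.prodMk_space hg)

theorem contMDiffOn_star' {f : X → B} {s : Set X} (hf : ContMDiffOn I 𝓘(ℝ, B) ∞ f s) :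
    ContMDiffOn I 𝓘(ℝ, B) ∞ (fun x => star (f x)) s :=
  ((starL' ℝ : B ≃L[ℝ] B) : B →L[ℝ] B).contMDiff.comp_contMDiffOn hf

theorem contMDiff_const_smul' {f : X → B} (c : ℝ) (hf : ContMDiff I 𝓘(ℝ, B) ∞ f) :
    ContMDiff I 𝓘(ℝ, B) ∞ (fun x => c • f x) :=
  (contDiff_const_smul c : ContDiff ℝ ∞ fun y : B => c • y).contMDiff.comp hf

theorem contMDiffOn_polar {z p : X → B} {s : Set X} (hz : ContMDiffOn I 𝓘(ℝ, B) ∞ z s)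
    (hpc : ContMDiffOn I 𝓘(ℝ, B) ∞ p s) (hp : ∀ x ∈ s, IsStarProjection (p x))
    (h : ∀ x ∈ s, ‖star (z x) * z x - p x‖ < sqrtRadius B) :
    ContMDiffOn I 𝓘(ℝ, B) ∞ (fun x => polar (z x) (p x)) s := by
  refine contMDiffOn_mul' hz (contMDiffOn_invSqrt
    ((contMDiffOn_mul' (contMDiffOn_star' hz) hz).add (contMDiffOn_const.sub hpc))
    (fun x hx => isSelfAdjoint_star_mul_self_add (hp x hx).isSelfAdjoint) fun x hx => ?_)
  convert h x hx using 2
  abel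

theorem contMDiffOn_align {p q : X → B} {s : Set X} (hpc : ContMDiffOn I 𝓘(ℝ, B) ∞ p s)
    (hqc : ContMDiffOn I 𝓘(ℝ, B) ∞ q s) (hp : ∀ x ∈ s, IsStarProjection (p x))
    (hq : ∀ x ∈ s, IsStarProjection (q x)) (h : ∀ x ∈ s, ‖p x - q x‖ < sqrtRadius B) :
    ContMDiffOn I 𝓘(ℝ, B) ∞ (fun x => align (p x) (q x)) s :=
  contMDiffOn_polar (contMDiffOn_mul' hqc hpc) hpc hp fun x hx =>
    (norm_star_mul_self_sub_le (hp x hx) (hq x hx)).trans_lt (h x hx)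

end PolarDecomposition

section Approximation

variable {E : Type*} [NormedAddCommGroup E] [NormedSpace ℝ E] [FiniteDimensional ℝ E]
  {H : Type*} [TopologicalSpace H] (I : ModelWithCorners ℝ E H) {X : Type*} [TopologicalSpace X]
  [CompactSpace X] [T2Space X] [ChartedSpace H X] [IsManifold I ∞ X]

theorem exists_contMDiff_norm_sub_lt {F : Type*} [NormedAddCommGroup F] [NormedSpace ℝ F]
    {f : X → F} (hf : Continuous f) {η : ℝ} (hη : 0 < η) :
    ∃ g : X → F, ContMDiff I 𝓘(ℝ, F) ∞ g ∧ ∀ x, ‖g x - f x‖ < η := by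
  obtain ⟨g, hg⟩ := exists_contMDiffMap_forall_mem_convex_of_local_const I (n := ⊤)
    (t := fun x => Metric.ball (f x) η) (fun x => convex_ball _ _) fun x => ⟨f x, by
      filter_upwards [hf.continuousAt.eventually (Metric.ball_mem_nhds (f x) hη)] with y hy
      exact Metric.mem_ball_comm.1 hy⟩
  exact ⟨g, g.contMDiff, fun x => by rw [← dist_eq_norm]; exact hg x⟩

/-- The spectral projection onto the positive part of an approximate symmetry `s`. -/
theorem isStarProjection_half_one_add {B : Type*} [CStarAlgebra B] {s : B} (hs : IsSelfAdjoint s)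
    (h : ‖s * s - 1‖ < 1) :
    IsStarProjection ((1 / 2 : ℝ) • (1 + s * invSqrt (s * s))) := by
  have hb : IsSelfAdjoint (s * s) := by simpa [hs.star_eq] using IsSelfAdjoint.star_mul_self s
  have hR := invSqrt_mul_self_mul hb (spectrum_pos_of_norm_sub_one_lt h)
  have hc : Commute (invSqrt (s * s)) s :=
    commute_invSqrt ((Commute.refl s).mul_left (Commute.refl s))
  set R := invSqrt (s * s) with hRd
  have hRs : star R = R := (isSelfAdjoint_invSqrt (s * s)).star_eq
  have h1 : s * R * (s * R) = 1 := by
    calc s * R * (s * R) = s * (R * s) * R := by noncomm_ring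
      _ = s * s * R * R := by rw [hc.eq]; noncomm_ring
      _ = R * R * (s * s) := by
        have : Commute (s * s) (R * R) := ((hc.mul_right hc).mul_left (hc.mul_right hc)).symm
        rw [mul_assoc, this.eq]
      _ = 1 := hR
  constructor
  · change _ * _ = _
    rw [smul_mul_smul_comm]
    have : (1 + s * R) * (1 + s * R) = (2 : ℝ) • (1 + s * R) := by
      rw [two_smul]
      calc (1 + s * R) * (1 + s * R) = 1 + s * R + s * R + s * R * (s * R) := by noncomm_ring
        _ = _ := by rw [h1]; abel
    rw [this, smul_smul]
    norm_num
  · change star _ = _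
    rw [star_smul, star_add, star_mul, hs.star_eq, hRs, hc.eq]
    simp

theorem norm_half_one_add_sub_le {B : Type*} [CStarAlgebra B] {a e : B} {η : ℝ}
    (ha : IsSelfAdjoint a) (he : IsStarProjection e) (hae : ‖a - e‖ ≤ η) (hη : η ≤ 1 / 100) :
    ‖((2 : ℝ) • a - 1) * ((2 : ℝ) • a - 1) - 1‖ ≤ 20 * η ∧
    ‖(1 / 2 : ℝ) • (1 + ((2 : ℝ) • a - 1) *
      invSqrt (((2 : ℝ) • a - 1) * ((2 : ℝ) • a - 1))) - e‖ ≤ 100 * η := by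
  have h0 : 0 ≤ η := (norm_nonneg _).trans hae
  set s := (2 : ℝ) • a - 1 with hs
  set t := (2 : ℝ) • e - 1 with ht
  have hone : ‖(1 : B)‖ ≤ 1 := (IsStarProjection.one B).norm_le
  have htt : t * t = 1 := by
    rw [ht, two_smul]
    have : (e + e - 1) * (e + e - 1) = 4 • (e * e) - 4 • e + 1 := by noncomm_ring
    rw [this, he.isIdempotentElem.eq, sub_self, zero_add]
  have hst : ‖s - t‖ ≤ 2 * η := by
    have : s - t = (2 : ℝ) • (a - e) := by rw [hs, ht, smul_sub]; abel
    rw [this, norm_smul, Real.norm_two]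
    linarith
  have htn : ‖t‖ ≤ 3 := by
    calc ‖t‖ ≤ ‖(2 : ℝ) • e‖ + ‖(1 : B)‖ := norm_sub_le _ _
      _ ≤ 2 * 1 + 1 := by
        rw [norm_smul, Real.norm_two]
        linarith [he.norm_le]
      _ = 3 := by norm_num
  have hsn : ‖s‖ ≤ 4 := by
    calc ‖s‖ = ‖s - t + t‖ := by rw [sub_add_cancel]
      _ ≤ ‖s - t‖ + ‖t‖ := norm_add_le _ _
      _ ≤ 4 := by linarith
  have h1 : ‖s * s - 1‖ ≤ 20 * η := by
    have e1 : s * s - 1 = (s - t) * s + t * (s - t) := by rw [← htt]; noncomm_ring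
    rw [e1]
    calc ‖(s - t) * s + t * (s - t)‖ ≤ ‖s - t‖ * ‖s‖ + ‖t‖ * ‖s - t‖ :=
          (norm_add_le _ _).trans (add_le_add (norm_mul_le _ _) (norm_mul_le _ _))
      _ ≤ 2 * η * 4 + 3 * (2 * η) := by gcongr
      _ ≤ 20 * η := by linarith
  refine ⟨h1, ?_⟩
  have hsa : IsSelfAdjoint s := ((IsSelfAdjoint.all (2 : ℝ)).smul ha).sub (IsSelfAdjoint.one B)
  have hb : IsSelfAdjoint (s * s) := by simpa [hsa.star_eq] using IsSelfAdjoint.star_mul_self s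
  have hR := norm_invSqrt_sub_one_le hb (h1.trans (by linarith))
  have e2 : (1 / 2 : ℝ) • (1 + s * invSqrt (s * s)) - e =
      (1 / 2 : ℝ) • (s * (invSqrt (s * s) - 1) + (s - t)) := by
    have : e = (1 / 2 : ℝ) • (1 + t) := by
      rw [ht, add_sub_cancel, smul_smul]; norm_num
    conv_lhs => rw [this]
    rw [← smul_sub]
    congr 1
    noncomm_ring
  rw [e2, norm_smul]
  have h3 : ‖s * (invSqrt (s * s) - 1) + (s - t)‖ ≤ 4 * (2 * (20 * η)) + 2 * η :=
    calc _ ≤ ‖s‖ * ‖invSqrt (s * s) - 1‖ + ‖s - t‖ :=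
          (norm_add_le _ _).trans (add_le_add_left (norm_mul_le _ _) _)
      _ ≤ 4 * (2 * (20 * η)) + 2 * η := by gcongr; linarith
  norm_num
  linarith

/-- A continuous projection valued function can be approximated by smooth ones. -/
theorem exists_contMDiff_isStarProjection {B : Type*} [CStarAlgebra B] {e : X → B}
    (hc : Continuous e) (he : ∀ x, IsStarProjection (e x)) {δ : ℝ} (hδ : 0 < δ) :
    ∃ p : X → B, ContMDiff I 𝓘(ℝ, B) ∞ p ∧ (∀ x, IsStarProjection (p x)) ∧
      ∀ x, ‖p x - e x‖ < δ := by
  set η := min (1 / 100) (min (δ / 200) (sqrtRadius B / 40)) with hη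
  have hη0 : 0 < η := by have := sqrtRadius_pos B; positivity
  have hη1 : η ≤ 1 / 100 := min_le_left _ _
  have hη2 : η ≤ δ / 200 := (min_le_right _ _).trans (min_le_left _ _)
  have hη3 : η ≤ sqrtRadius B / 40 := (min_le_right _ _).trans (min_le_right _ _)
  obtain ⟨g, hg, hge⟩ := exists_contMDiff_norm_sub_lt I hc hη0
  set a : X → B := fun x => (1 / 2 : ℝ) • (g x + star (g x)) with ha
  have hgs : ContMDiff I 𝓘(ℝ, B) ∞ fun x => star (g x) :=
    contMDiffOn_univ.1 (contMDiffOn_star' hg.contMDiffOn)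
  have has : ContMDiff I 𝓘(ℝ, B) ∞ a := contMDiff_const_smul' _ (hg.add hgs)
  have hsa : ∀ x, IsSelfAdjoint (a x) := fun x =>
    (IsSelfAdjoint.all (1 / 2 : ℝ)).smul (IsSelfAdjoint.add_star_self (g x))
  have hae : ∀ x, ‖a x - e x‖ ≤ η := fun x => by
    have e1 : a x - e x = (1 / 2 : ℝ) • ((g x - e x) + star (g x - e x)) := by
      have : e x = (1 / 2 : ℝ) • (e x + e x) := by rw [← two_smul ℝ (e x), smul_smul]; norm_num
      conv_lhs => rw [this]
      rw [star_sub, (he x).isSelfAdjoint.star_eq, ha, ← smul_sub]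
      congr 1
      abel
    rw [e1, norm_smul]
    have := norm_add_le (g x - e x) (star (g x - e x))
    rw [norm_star] at this
    have h2 := hge x
    rw [Real.norm_of_nonneg (by norm_num)]
    linarith
  have hb := fun x => norm_half_one_add_sub_le (hsa x) (he x) (hae x) hη1
  set s : X → B := fun x => (2 : ℝ) • a x - 1 with hs
  have hss : ContMDiff I 𝓘(ℝ, B) ∞ s := (contMDiff_const_smul' _ has).sub contMDiff_const
  have hssa : ∀ x, IsSelfAdjoint (s x) := fun x =>
    ((IsSelfAdjoint.all (2 : ℝ)).smul (hsa x)).sub (IsSelfAdjoint.one B)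
  have hr1 := sqrtRadius_le_one B
  have hr0 := sqrtRadius_pos B
  refine ⟨fun x => (1 / 2 : ℝ) • (1 + s x * invSqrt (s x * s x)), ?_, fun x => ?_, fun x => ?_⟩
  · refine contMDiff_const_smul' _ (contMDiff_const.add ?_)
    rw [← contMDiffOn_univ]
    refine contMDiffOn_mul' hss.contMDiffOn (contMDiffOn_invSqrt
      (contMDiffOn_mul' hss.contMDiffOn hss.contMDiffOn) (fun x _ => ?_) fun x _ => ?_)
    · simpa [(hssa x).star_eq] using IsSelfAdjoint.star_mul_self (s x)
    · exact (hb x).1.trans_lt (by linarith)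
  · exact isStarProjection_half_one_add (hssa x) ((hb x).1.trans_lt (by linarith))
  · exact (hb x).2.trans_lt (by linarith)

end Approximation

namespace HilbertModule

universe w₁ w₂ w₃

variable {A : Type u} [CStarAlgebra A] [PartialOrder A] [StarOrderedRing A]

section InnerProduct

variable (V : HilbertModule.{u, w₁} A)

theorem star_ip (x y : V) : star (V.ip x y) = V.ip y x := by
  have := CStarModule.star_inner (A := Aᵐᵒᵖ) x y
  simp only [ip]
  rw [← this]
  rfl

theorem ip_add_right (x y z : V) : V.ip x (y + z) = V.ip x y + V.ip x z := by
  simp [ip, CStarModule.inner_add_right]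

theorem ip_add_left (x y z : V) : V.ip (x + y) z = V.ip x z + V.ip y z := by
  simp [ip, CStarModule.inner_add_left]

theorem ip_sub_left (x y z : V) : V.ip (x - y) z = V.ip x z - V.ip y z := by
  simp [ip, CStarModule.inner_sub_left]

theorem ip_zero_left (x : V) : V.ip 0 x = 0 := by simp [ip]

theorem ip_zero_right (x : V) : V.ip x 0 = 0 := by simp [ip]

theorem ip_smul_right_op (x y : V) (a : Aᵐᵒᵖ) : V.ip x (a • y) = V.ip x y * unop a :=
  V.ip_smul_right x y (unop a)

theorem ip_smul_left_op (x y : V) (a : Aᵐᵒᵖ) : V.ip (a • x) y = star (unop a) * V.ip x y := by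
  rw [← star_ip, ip_smul_right_op, star_mul, star_ip]

theorem ip_real_smul_right (x y : V) (c : ℝ) : V.ip x (c • y) = c • V.ip x y := by
  simp [ip, CStarModule.inner_smul_right_real]

theorem ip_real_smul_left (x y : V) (c : ℝ) : V.ip (c • x) y = c • V.ip x y := by
  simp [ip, CStarModule.inner_smul_left_real]

theorem ip_sum_right {ι : Type*} (s : Finset ι) (x : V) (y : ι → V) :
    V.ip x (∑ i ∈ s, y i) = ∑ i ∈ s, V.ip x (y i) := by
  simp [ip, CStarModule.inner_sum_right]

theorem ip_sum_left {ι : Type*} (s : Finset ι) (x : ι → V) (y : V) :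
    V.ip (∑ i ∈ s, x i) y = ∑ i ∈ s, V.ip (x i) y := by
  simp [ip, CStarModule.inner_sum_left]

theorem ip_self_eq_zero {x : V} (h : V.ip x x = 0) : x = 0 := by
  have : inner Aᵐᵒᵖ x x = 0 := unop_injective h
  exact CStarModule.inner_self.1 this

theorem ip_ext {x y : V} (h : ∀ z, V.ip x z = V.ip y z) : x = y := by
  rw [← sub_eq_zero]
  apply V.ip_self_eq_zero
  rw [ip_sub_left, h, sub_self]

theorem continuous_ip : Continuous fun p : V × V => V.ip p.1 p.2 :=
  continuous_unop.comp (CStarModule.continuous_inner (A := Aᵐᵒᵖ) (E := V))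

end InnerProduct

namespace Hom

variable {U : HilbertModule.{u, w₁} A} {V : HilbertModule.{u, w₂} A} {W : HilbertModule.{u, w₃} A}

theorem ext {T S : Hom V W} (h : ∀ v, T.1 v = S.1 v) : T = S :=
  Subtype.ext (ContinuousLinearMap.ext h)

theorem map_op_smul (T : Hom V W) (a : Aᵐᵒᵖ) (v : V) : T.1 (a • v) = a • T.1 v :=
  T.2.1 (unop a) v

/-- A map of Hilbert modules with an adjoint is linear and bounded, by the closed graph theorem. -/
noncomputable def ofAdjoint (f : V → W) (g : W → V)
    (h : ∀ v w, W.ip (f v) w = V.ip v (g w)) : Hom V W :=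
  let L : V →ₗ[ℂ] W :=
    { toFun := f
      map_add' := fun x y => W.ip_ext fun z => by
        rw [h, V.ip_add_left, W.ip_add_left, h, h]
      map_smul' := fun c x => W.ip_ext fun z => by
        have e := h x z
        rw [h]
        simp only [ip, RingHom.id_apply] at e ⊢
        simp [e] }
  have hL : Continuous L := by
    refine L.continuous_of_isClosed_graph ?_
    have : (L.graph : Set (V × W)) = ⋂ z : W, {p : V × W | W.ip p.2 z = V.ip p.1 (g z)} := by
      ext p
      simp only [SetLike.mem_coe, LinearMap.mem_graph_iff, Set.mem_iInter, Set.mem_ofPred_eq]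
      constructor
      · intro hp z
        rw [hp]
        exact h _ _
      · intro hp
        refine W.ip_ext fun z => (hp z).trans (h _ _).symm
    rw [this]
    refine isClosed_iInter fun z => isClosed_eq ?_ ?_
    · exact W.continuous_ip.comp (continuous_snd.prodMk continuous_const)
    · exact V.continuous_ip.comp (continuous_fst.prodMk continuous_const)
  have hg : Continuous g := by
    let M : W →ₗ[ℂ] V :=
      { toFun := g
        map_add' := fun x y => V.ip_ext fun z => by
          rw [← V.star_ip, ← h, W.ip_add_right, V.ip_add_left, h, h, star_add, V.star_ip, V.star_ip]
        map_smul' := fun c x => V.ip_ext fun z => by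
          have e := h z x
          rw [← V.star_ip, ← h, ← V.star_ip z]
          simp only [ip, RingHom.id_apply] at e ⊢
          simp [e] }
    refine M.continuous_of_isClosed_graph ?_
    have : (M.graph : Set (W × V)) = ⋂ z : V, {p : W × V | V.ip z p.2 = W.ip (f z) p.1} := by
      ext p
      simp only [SetLike.mem_coe, LinearMap.mem_graph_iff, Set.mem_iInter, Set.mem_ofPred_eq]
      constructor
      · intro hp z
        rw [hp]
        exact (h _ _).symm
      · intro hp
        refine V.ip_ext fun z => ?_
        rw [← V.star_ip, hp, h, V.star_ip]
        rfl
    rw [this]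
    refine isClosed_iInter fun z => isClosed_eq ?_ ?_
    · exact V.continuous_ip.comp (continuous_const.prodMk continuous_snd)
    · exact W.continuous_ip.comp (continuous_const.prodMk continuous_fst)
  ⟨⟨L, hL⟩, fun a v => W.ip_ext fun z => by
      change W.ip (f _) z = W.ip (op a • f v) z
      rw [h, V.ip_smul_left_op, W.ip_smul_left_op, h],
    ⟨{ toFun := g
       map_add' := fun x y => V.ip_ext fun z => by
          rw [← V.star_ip, ← h, W.ip_add_right, V.ip_add_left, h, h, star_add, V.star_ip, V.star_ip]
       map_smul' := fun c x => V.ip_ext fun z => by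
          have e := h z x
          rw [← V.star_ip, ← h, ← V.star_ip z]
          simp only [ip, RingHom.id_apply] at e ⊢
          simp [e]
       cont := hg }, h⟩⟩

/-- Composition of adjointable maps. -/
def comp (T : Hom V W) (S : Hom U V) : Hom U W :=
  ⟨T.1.comp S.1, fun a v => by simp [S.2.1, T.2.1], by
    obtain ⟨T', hT⟩ := T.2.2
    obtain ⟨S', hS⟩ := S.2.2
    exact ⟨S'.comp T', fun v w => by
      rw [ContinuousLinearMap.comp_apply, ContinuousLinearMap.comp_apply, hT, hS]⟩⟩

@[simp]
theorem comp_apply (T : Hom V W) (S : Hom U V) (x : U) : (comp T S).1 x = T.1 (S.1 x) := rfl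

theorem isBoundedBilinearMap_comp :
    IsBoundedBilinearMap ℝ fun p : Hom V W × Hom U V => comp p.1 p.2 where
  add_left _ _ _ := ext fun _ => rfl
  smul_left _ _ _ := ext fun _ => rfl
  add_right T _ _ := ext fun _ => map_add T.1 _ _
  smul_right c T S := ext fun x => (T.1.restrictScalars ℝ).map_smul c (S.1 x)
  bound := ⟨1, one_pos, fun T S => by
    rw [one_mul]
    exact ContinuousLinearMap.opNorm_comp_le T.1 S.1⟩

variable {E : Type*} [NormedAddCommGroup E] [NormedSpace ℝ E] {H : Type*} [TopologicalSpace H]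
  {I : ModelWithCorners ℝ E H} {X : Type*} [TopologicalSpace X] [ChartedSpace H X]

theorem contMDiffOn_comp {T : X → Hom V W} {S : X → Hom U V} {s : Set X}
    (hT : ContMDiffOn I 𝓘(ℝ, Hom V W) ∞ T s) (hS : ContMDiffOn I 𝓘(ℝ, Hom U V) ∞ S s) :
    ContMDiffOn I 𝓘(ℝ, Hom U W) ∞ (fun x => comp (T x) (S x)) s := by
  have h : ContDiff ℝ ∞ fun p : Hom V W × Hom U V => comp p.1 p.2 :=
    isBoundedBilinearMap_comp.contDiff
  have h' := hT.prodMk_space hS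
  exact h.contMDiff.comp_contMDiffOn h'

end Hom

namespace IsometricIso

variable {V : HilbertModule.{u, w₁} A} {W : HilbertModule.{u, w₂} A}

/-- The inverse isomorphism. -/
def symm (f : IsometricIso V W) : IsometricIso W V where
  toLinearEquiv := f.toLinearEquiv.symm
  ip_map v₁ v₂ := by rw [← f.ip_map]; simp

theorem ip_apply_left (f : IsometricIso V W) (v : V) (w : W) :
    W.ip (f.toLinearEquiv v) w = V.ip v (f.toLinearEquiv.symm w) := by
  rw [← f.ip_map]; simp

/-- An isometric isomorphism as an adjointable map. -/
noncomputable def toHom (f : IsometricIso V W) : Hom V W :=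
  Hom.ofAdjoint f.toLinearEquiv f.toLinearEquiv.symm f.ip_apply_left

end IsometricIso

section Matrix

variable {n : ℕ}

theorem continuous_std_apply (i : Fin n) : Continuous fun v : std A n => v i :=
  (continuous_apply i).comp
    (continuous_induced_dom : Continuous (WithCStarModule.equiv Aᵐᵒᵖ (Fin n → Aᵐᵒᵖ)))

theorem std_ext {v w : std A n} (h : ∀ i, v i = w i) : v = w := WithCStarModule.ext (A := Aᵐᵒᵖ) h

theorem matrixAct_apply (M : CStarMatrix (Fin n) (Fin n) A) (v : std A n) (i : Fin n) :
    matrixAct M v i = op (∑ j, M i j * unop (v j)) := rfl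

theorem matrixAct_one (v : std A n) : matrixAct (1 : CStarMatrix (Fin n) (Fin n) A) v = v := by
  refine std_ext fun i => ?_
  rw [matrixAct_apply, Finset.sum_eq_single i]
  · rw [CStarMatrix.one_apply_eq, one_mul, op_unop]
  · intro j _ hj
    rw [CStarMatrix.one_apply_ne' hj, zero_mul]
  · simp

theorem matrixAct_add (M N : CStarMatrix (Fin n) (Fin n) A) (v : std A n) :
    matrixAct (M + N) v = matrixAct M v + matrixAct N v := by
  refine std_ext fun i => ?_
  rw [WithCStarModule.add_apply]
  change op (∑ j, (M i j + N i j) * unop (v j)) =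
    op (∑ j, M i j * unop (v j)) + op (∑ j, N i j * unop (v j))
  simp only [← op_add, ← Finset.sum_add_distrib, add_mul]

theorem matrixAct_real_smul (c : ℝ) (M : CStarMatrix (Fin n) (Fin n) A) (v : std A n) :
    matrixAct (c • M) v = c • matrixAct M v := by
  refine std_ext fun i => ?_
  rw [WithCStarModule.smul_apply]
  change op (∑ j, (c • M i j) * unop (v j)) = c • op (∑ j, M i j * unop (v j))
  simp only [← op_smul, Finset.smul_sum, smul_mul_assoc]

theorem ip_matrixAct (M : CStarMatrix (Fin n) (Fin n) A) (v w : std A n) :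
    (std A n).ip (matrixAct M v) w = (std A n).ip v (matrixAct (star M) w) := by
  rw [std_ip, std_ip]
  change ∑ i, star (∑ j, M i j * unop (v j)) * unop (w i) =
    ∑ i, star (unop (v i)) * ∑ j, star (M j i) * unop (w j)
  simp only [star_sum, Finset.sum_mul, Finset.mul_sum, star_mul, mul_assoc]
  exact Finset.sum_comm

/-- The adjointable map of `Aⁿ` given by a matrix. -/
noncomputable def matHom (M : CStarMatrix (Fin n) (Fin n) A) : Hom (std A n) (std A n) :=
  Hom.ofAdjoint (matrixAct M) (matrixAct (star M)) (ip_matrixAct M)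

theorem norm_matrixAct_le (M : CStarMatrix (Fin n) (Fin n) A) (v : std A n) :
    ‖matrixAct M v‖ ≤ (n * n : ℝ) * ‖M‖ * ‖v‖ := by
  calc ‖matrixAct M v‖ ≤ ∑ i, ‖matrixAct M v i‖ := WithCStarModule.pi_norm_le_sum_norm _
    _ ≤ ∑ _i : Fin n, ∑ _j : Fin n, ‖M‖ * ‖v‖ := by
      refine Finset.sum_le_sum fun i _ => ?_
      rw [matrixAct_apply, MulOpposite.norm_op]
      refine (norm_sum_le _ _).trans (Finset.sum_le_sum fun j _ => (norm_mul_le _ _).trans ?_)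
      gcongr
      · exact CStarMatrix.norm_entry_le_norm
      · rw [MulOpposite.norm_unop]
        exact WithCStarModule.norm_apply_le_norm v j
    _ = _ := by simp; ring

/-- The matrices as adjointable maps of `Aⁿ`. -/
noncomputable def matHomL (A : Type u) [CStarAlgebra A] [PartialOrder A] [StarOrderedRing A]
    (n : ℕ) : CStarMatrix (Fin n) (Fin n) A →L[ℝ] Hom (std A n) (std A n) :=
  LinearMap.mkContinuous
    { toFun := matHom
      map_add' := fun M N => Hom.ext fun v => matrixAct_add M N v
      map_smul' := fun c M => Hom.ext fun v => matrixAct_real_smul c M v } (n * n : ℝ)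
    fun M => ContinuousLinearMap.opNorm_le_bound (matHom M).1 (by positivity)
      (norm_matrixAct_le M)

/-- The standard basis vectors of `Aⁿ`. -/
noncomputable def stdBasis (n : ℕ) (j : Fin n) : std A n :=
  (WithCStarModule.equiv Aᵐᵒᵖ (Fin n → Aᵐᵒᵖ)).symm (Pi.single j 1)

theorem sum_smul_stdBasis (v : std A n) : ∑ j, v j • stdBasis n j = v := by
  apply (WithCStarModule.equiv Aᵐᵒᵖ (Fin n → Aᵐᵒᵖ)).injective
  change (∑ j, (v j • (Pi.single j 1 : Fin n → Aᵐᵒᵖ)) : Fin n → Aᵐᵒᵖ) = fun i => v i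
  ext i
  rw [Finset.sum_apply, Finset.sum_eq_single i]
  · simp
  · intro j _ hj
    simp [hj.symm]
  · simp

/-- The matrix of an `A`-linear map of `Aⁿ`. -/
noncomputable def toMat (L : std A n → std A n) : CStarMatrix (Fin n) (Fin n) A :=
  CStarMatrix.ofMatrix fun i j => unop (L (stdBasis n j) i)

theorem matrixAct_toMat (L : std A n →ₗ[Aᵐᵒᵖ] std A n) (v : std A n) :
    matrixAct (toMat L) v = L v := by
  conv_rhs => rw [← sum_smul_stdBasis v, map_sum]
  refine std_ext fun i => ?_
  have : ∀ (s : Finset (Fin n)) (f : Fin n → std A n), (∑ j ∈ s, f j) i = ∑ j ∈ s, f j i :=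
    fun s f => Finset.sum_apply i s f
  rw [this, matrixAct_apply, Finset.op_sum]
  refine Finset.sum_congr rfl fun j _ => ?_
  rw [map_smul]
  rfl

theorem matrixAct_injective {M N : CStarMatrix (Fin n) (Fin n) A}
    (h : ∀ v, matrixAct M v = matrixAct N v) : M = N := by
  have e : ∀ M : CStarMatrix (Fin n) (Fin n) A, toMat (matrixAct M) = M := fun M => by
    apply CStarMatrix.ext
    intro i j
    change unop (matrixAct M (stdBasis n j) i) = _
    rw [matrixAct_apply, unop_op, Finset.sum_eq_single j]
    · change M i j * unop ((Pi.single j 1 : Fin n → Aᵐᵒᵖ) j) = _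
      simp
    · intro k _ hk
      change M i k * unop ((Pi.single j 1 : Fin n → Aᵐᵒᵖ) k) = _
      simp [hk]
    · simp
  rw [← e M, ← e N]
  congr 1
  exact funext h

theorem continuous_toMat {Y : Type*} [TopologicalSpace Y] {L : Y → std A n → std A n}
    (h : ∀ v, Continuous fun y => L y v) : Continuous fun y => toMat (L y) :=
  continuous_pi fun i => continuous_pi fun _ =>
    continuous_unop.comp ((continuous_std_apply i).comp (h _))

theorem continuous_matrixAct_uncurry :
    Continuous fun p : CStarMatrix (Fin n) (Fin n) A × std A n => matrixAct p.1 p.2 := by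
  have h1 : Continuous fun p : CStarMatrix (Fin n) (Fin n) A × std A n => (matHomL A n p.1).1 :=
    continuous_subtype_val.comp ((matHomL A n).continuous.comp continuous_fst)
  exact h1.clm_apply continuous_snd

theorem contDiff_of_isLinear {E F : Type*} [NormedAddCommGroup E] [NormedSpace ℝ E]
    [NormedAddCommGroup F] [NormedSpace ℝ F] {f : E → F} (hadd : ∀ x y, f (x + y) = f x + f y)
    (hsmul : ∀ (c : ℝ) x, f (c • x) = c • f x) (hc : Continuous f) : ContDiff ℝ ∞ f :=
  (⟨⟨⟨f, hadd⟩, hsmul⟩, hc⟩ : E →L[ℝ] F).contDiff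

theorem contDiff_matHom :
    ContDiff ℝ ∞ (matHom : CStarMatrix (Fin n) (Fin n) A → Hom (std A n) (std A n)) :=
  contDiff_of_isLinear (fun M N => (matHomL A n).map_add M N)
    (fun c M => (matHomL A n).map_smul c M) (matHomL A n).continuous

theorem contDiff_toMat :
    ContDiff ℝ ∞ fun T : Hom (std A n) (std A n) => toMat T.1 :=
  contDiff_of_isLinear (fun _ _ => rfl) (fun _ _ => rfl) (continuous_toMat fun v =>
    (ContinuousLinearMap.apply ℂ (std A n) v).continuous.comp continuous_subtype_val)

end Matrix

end HilbertModule

namespace HilbertModuleFamily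

open HilbertModule Filter Topology

universe w₁ w₂ w₃

variable {A : Type u} [CStarAlgebra A] [PartialOrder A] [StarOrderedRing A] {X : Type v}
  [TopologicalSpace X]

namespace LocalTrivialization

variable {W : HilbertModuleFamily.{u, v, w} A X} (e : W.LocalTrivialization)

/-- The isomorphism of the fiber over a point of the base set with the model. -/
noncomputable def fiberIso {x : X} (hx : x ∈ e.triv.baseSet) : IsometricIso (W.fiber x) e.model :=
  (e.isometric x hx).choose

theorem fiberIso_apply {x : X} (hx : x ∈ e.triv.baseSet) (v : W.fiber x) :
    (e.fiberIso hx).toLinearEquiv v = e.coord x v :=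
  ((e.isometric x hx).choose_spec v).symm

theorem coord_fiberIso_symm {x : X} (hx : x ∈ e.triv.baseSet) (v : e.model) :
    e.coord x ((e.fiberIso hx).toLinearEquiv.symm v) = v := by
  rw [← e.fiberIso_apply hx, LinearEquiv.apply_symm_apply]

theorem coord_injective {x : X} (hx : x ∈ e.triv.baseSet) {v v' : W.fiber x}
    (h : e.coord x v = e.coord x v') : v = v' := by
  rw [← e.fiberIso_apply hx, ← e.fiberIso_apply hx] at h
  exact (e.fiberIso hx).toLinearEquiv.injective h

theorem triv_apply {q : W.Total} (hq : q.base ∈ e.triv.baseSet) :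
    e.triv q = (q.base, e.coord q.base q.vec) :=
  Prod.ext (e.triv.coe_fst (e.triv.mem_source.2 hq)) rfl

theorem continuousAt_coord {Y : Type*} [TopologicalSpace Y] {f : Y → W.Total} {y : Y}
    (hf : ContinuousAt f y) (hy : (f y).base ∈ e.triv.baseSet) :
    ContinuousAt (fun z => e.coord (f z).base (f z).vec) y :=
  (continuous_snd.continuousAt.comp
    (e.triv.toOpenPartialHomeomorph.continuousAt (e.triv.mem_source.2 hy))).comp hf

theorem continuousAt_total {Y : Type*} [TopologicalSpace Y] {f : Y → W.Total} {y : Y}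
    (hb : ContinuousAt (fun z => (f z).base) y) (hy : (f y).base ∈ e.triv.baseSet)
    (hf : ContinuousAt (fun z => e.coord (f z).base (f z).vec) y) : ContinuousAt f y := by
  have hev : ∀ᶠ z in 𝓝 y, (f z).base ∈ e.triv.baseSet :=
    hb.eventually (e.triv.open_baseSet.mem_nhds hy)
  rw [e.triv.toOpenPartialHomeomorph.continuousAt_iff_continuousAt_comp_left
    (hev.mono fun z hz => e.triv.mem_source.2 hz)]
  refine (hb.prodMk hf).congr (hev.mono fun z hz => ?_)
  exact (e.triv_apply hz).symm

end LocalTrivialization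

theorem IsBundle.continuous_proj {W : HilbertModuleFamily.{u, v, w} A X} (hW : W.IsBundle) :
    Continuous W.proj := by
  rw [continuous_iff_continuousAt]
  intro q
  obtain ⟨e, he⟩ := hW q.base
  exact e.triv.continuousAt_proj (e.triv.mem_source.2 he)

section Smooth

variable {E : Type*} [NormedAddCommGroup E] [NormedSpace ℝ E] {H : Type*} [TopologicalSpace H]
  {I : ModelWithCorners ℝ E H} [ChartedSpace H X]
  {W₁ : HilbertModuleFamily.{u, v, w₁} A X} {W₂ : HilbertModuleFamily.{u, v, w₂} A X}
  {W₃ : HilbertModuleFamily.{u, v, w₃} A X}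

theorem smoothInCoords_of_local {e₁ : W₁.LocalTrivialization} {e₂ : W₂.LocalTrivialization}
    {f : ∀ x, W₁.fiber x → W₂.fiber x}
    (h : ∀ x ∈ e₁.triv.baseSet ∩ e₂.triv.baseSet, ∃ O ∈ 𝓝 x, ∃ g : X → Hom e₁.model e₂.model,
      ContMDiffOn I 𝓘(ℝ, Hom e₁.model e₂.model) ∞ g O ∧
      ∀ y ∈ O, y ∈ e₁.triv.baseSet ∩ e₂.triv.baseSet → ∀ v : W₁.fiber y,
        (g y).1 (e₁.coord y v) = e₂.coord y (f y v)) :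
    SmoothInCoords I e₁ e₂ f := by
  classical
  choose! O hO g hg hgf using h
  refine ⟨fun x => g x x, fun x hx => ?_, fun x hx v => hgf x hx x (mem_of_mem_nhds (hO x hx)) hx v⟩
  have h1 : ContMDiffAt I 𝓘(ℝ, Hom e₁.model e₂.model) ∞ (g x) x := (hg x hx).contMDiffAt (hO x hx)
  refine (h1.congr_of_eventuallyEq ?_).contMDiffWithinAt
  have hbase := (e₁.triv.open_baseSet.inter e₂.triv.open_baseSet).mem_nhds hx
  filter_upwards [hO x hx, hbase] with y hy hyb
  refine Hom.ext fun v => ?_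
  obtain ⟨v, rfl⟩ := (e₁.fiberIso hyb.1).toLinearEquiv.surjective v
  rw [e₁.fiberIso_apply]
  exact (hgf y hyb y (mem_of_mem_nhds (hO y hyb)) hyb v).trans (hgf x hx y hy hyb v).symm

theorem IsSmoothMap.comp {S₁ : SmoothStructure I W₁} {S₂ : SmoothStructure I W₂}
    {S₃ : SmoothStructure I W₃} {g : ∀ x, W₂.fiber x → W₃.fiber x}
    {f : ∀ x, W₁.fiber x → W₂.fiber x} (hg : IsSmoothMap S₂ S₃ g) (hf : IsSmoothMap S₁ S₂ f) :
    IsSmoothMap S₁ S₃ fun x v => g x (f x v) := by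
  intro e₁ he₁ e₃ he₃
  refine smoothInCoords_of_local fun x hx => ?_
  obtain ⟨e₂, he₂, hxe⟩ := S₂.exists_mem x
  obtain ⟨F, hF, hFf⟩ := hf e₁ he₁ e₂ he₂
  obtain ⟨G, hG, hGg⟩ := hg e₂ he₂ e₃ he₃
  refine ⟨(e₁.triv.baseSet ∩ e₃.triv.baseSet) ∩ e₂.triv.baseSet,
    ((e₁.triv.open_baseSet.inter e₃.triv.open_baseSet).inter e₂.triv.open_baseSet).mem_nhds
      ⟨hx, hxe⟩, fun y => Hom.comp (G y) (F y), ?_, fun y hy _ v => ?_⟩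
  · exact Hom.contMDiffOn_comp (hG.mono fun y hy => ⟨hy.2, hy.1.2⟩)
      (hF.mono fun y hy => ⟨hy.1.1, hy.2⟩)
  · rw [Hom.comp_apply]
    exact (congrArg _ (hFf y ⟨hy.1.1, hy.2⟩ v)).trans (hGg y ⟨hy.2, hy.1.2⟩ _)

theorem SmoothInCoords.sum {ι : Type*} {s : Finset ι} {e₁ : W₁.LocalTrivialization}
    {e₂ : W₂.LocalTrivialization} {f : ι → ∀ x, W₁.fiber x → W₂.fiber x}
    (h : ∀ i ∈ s, SmoothInCoords I e₁ e₂ (f i)) :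
    SmoothInCoords I e₁ e₂ fun x v => ∑ i ∈ s, f i x v := by
  choose! g hg hgf using h
  refine ⟨fun x => ∑ i ∈ s, g i x, contMDiffOn_finsetSum hg, fun x hx v => ?_⟩
  have : ((∑ i ∈ s, g i x : Hom e₁.model e₂.model) : e₁.model →L[ℂ] e₂.model) (e₁.coord x v) =
      ∑ i ∈ s, (g i x).1 (e₁.coord x v) := by
    rw [Submodule.coe_sum, sum_apply]
  rw [this, ← e₂.fiberIso_apply hx.2, map_sum]
  refine Finset.sum_congr rfl fun i hi => ?_
  rw [e₂.fiberIso_apply]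
  exact hgf i hi x hx v

/-- A fiberwise map of trivial bundles given by a smooth function with values in `Hom` is smooth. -/
theorem isSmoothMap_trivial {V₁ : HilbertModule.{u, w₁} A} {V₂ : HilbertModule.{u, w₂} A}
    {g : X → Hom V₁ V₂} (hg : ContMDiff I 𝓘(ℝ, Hom V₁ V₂) ∞ g) :
    IsSmoothMap (trivialSmooth I X V₁) (trivialSmooth I X V₂) fun x v => (g x).1 v := by
  rintro _ rfl _ rfl
  exact ⟨g, hg.contMDiffOn, fun _ _ _ => rfl⟩

end Smooth

end HilbertModuleFamily

namespace HilbertModuleFamily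

open HilbertModule Filter Topology

universe w₁ w₂ w₃

variable {A : Type u} [CStarAlgebra A] [PartialOrder A] [StarOrderedRing A] {X : Type v}
  [TopologicalSpace X]

/-- A continuous isometric embedding `J` of a family of Hilbert modules in the trivial bundle
`X × Aⁿ`, together with its fiberwise adjoint `K`. -/
structure Frame (W : HilbertModuleFamily.{u, v, w} A X) (n : ℕ) where
  J : ∀ x, Hom (W.fiber x) (std A n)
  K : ∀ x, Hom (std A n) (W.fiber x)
  ip_J : ∀ x (v : W.fiber x) (a : std A n),
    (std A n).ip ((J x).1 v) a = (W.fiber x).ip v ((K x).1 a)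
  K_J : ∀ x (v : W.fiber x), (K x).1 ((J x).1 v) = v
  continuous_J : Continuous fun q : W.Total => ((q.base, (J q.base).1 q.vec) : X × std A n)
  continuous_K : Continuous fun q : X × std A n => (⟨q.1, (K q.1).1 q.2⟩ : W.Total)

namespace Frame

variable {n : ℕ} {W : HilbertModuleFamily.{u, v, w} A X} (F : W.Frame n)

theorem ip_K (x : X) (a : std A n) (v : W.fiber x) :
    (W.fiber x).ip ((F.K x).1 a) v = (std A n).ip a ((F.J x).1 v) := by
  rw [← (W.fiber x).star_ip, ← F.ip_J, (std A n).star_ip]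

theorem ip_J_J (x : X) (v v' : W.fiber x) :
    (std A n).ip ((F.J x).1 v) ((F.J x).1 v') = (W.fiber x).ip v v' := by
  rw [F.ip_J, F.K_J]

/-- The matrix of `J K`. -/
noncomputable def gramMatrix (x : X) : CStarMatrix (Fin n) (Fin n) A :=
  toMat fun a => (F.J x).1 ((F.K x).1 a)

theorem gramMatrix_act (x : X) (a : std A n) :
    matrixAct (F.gramMatrix x) a = (F.J x).1 ((F.K x).1 a) :=
  matrixAct_toMat
    { toFun := fun a => (F.J x).1 ((F.K x).1 a)
      map_add' := fun a b => by rw [map_add, map_add]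
      map_smul' := fun c a => by
        rw [Hom.map_op_smul, Hom.map_op_smul, RingHom.id_apply] } a

theorem gramMatrix_act_J (x : X) (v : W.fiber x) :
    matrixAct (F.gramMatrix x) ((F.J x).1 v) = (F.J x).1 v := by
  rw [gramMatrix_act, F.K_J]

theorem K_gramMatrix_act (x : X) (a : std A n) :
    (F.K x).1 (matrixAct (F.gramMatrix x) a) = (F.K x).1 a := by
  rw [gramMatrix_act, F.K_J]

theorem isStarProjection_gramMatrix (x : X) : IsStarProjection (F.gramMatrix x) where
  isIdempotentElem := matrixAct_injective fun v => by
    rw [matrixAct_mul, gramMatrix_act, K_gramMatrix_act, gramMatrix_act]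
  isSelfAdjoint := matrixAct_injective fun v => (std A n).ip_ext fun z => by
    rw [ip_matrixAct, star_star, gramMatrix_act, gramMatrix_act, F.ip_J, ← F.ip_K]

theorem continuous_gramMatrix : Continuous F.gramMatrix := by
  refine continuous_toMat fun v => ?_
  exact continuous_snd.comp (F.continuous_J.comp (F.continuous_K.comp
    (continuous_id.prodMk continuous_const)))

/-- The projection valued function whose image is isomorphic to `W`. -/
noncomputable def gram : ProjectionFunction A X n where
  toFun := F.gramMatrix
  continuous_toFun := F.continuous_gramMatrix
  isStarProjection := F.isStarProjection_gramMatrix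

theorem continuousAt_J {Y : Type*} [TopologicalSpace Y] {f : Y → W.Total} {y : Y}
    (hf : ContinuousAt f y) : ContinuousAt (fun z => (F.J (f z).base).1 (f z).vec) y :=
  (continuous_snd.comp F.continuous_J).continuousAt.comp hf

theorem continuousAt_base (F : W.Frame n) {Y : Type*} [TopologicalSpace Y] {f : Y → W.Total} {y : Y}
    (hf : ContinuousAt f y) : ContinuousAt (fun z => (f z).base) y :=
  (continuous_fst.comp F.continuous_J).continuousAt.comp hf

theorem continuousAt_K {Y : Type*} [TopologicalSpace Y] {b : Y → X} {f : Y → std A n} {y : Y}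
    (hb : ContinuousAt b y) (hf : ContinuousAt f y) :
    ContinuousAt (fun z => (⟨b z, (F.K (b z)).1 (f z)⟩ : W.Total)) y :=
  F.continuous_K.continuousAt.comp (f := fun z => (b z, f z)) (hb.prodMk hf)

section Iso

variable {W₁ : HilbertModuleFamily.{u, v, w₁} A X} {W₂ : HilbertModuleFamily.{u, v, w₂} A X}
  (F₁ : W₁.Frame n) (F₂ : W₂.Frame n)

theorem mul_gramMatrix {x : X} {U : CStarMatrix (Fin n) (Fin n) A}
    (h : star U * U = F₁.gramMatrix x) : U * F₁.gramMatrix x = U :=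
  mul_initial_of_star_mul_self (F₁.isStarProjection_gramMatrix x) h

theorem gramMatrix_mul {x : X} {U : CStarMatrix (Fin n) (Fin n) A}
    (h : U * star U = F₂.gramMatrix x) : F₂.gramMatrix x * U = U :=
  final_mul_of_mul_star_self (F₂.isStarProjection_gramMatrix x) h

/-- A partial isometry between the ranges of the Gram matrices at `x` and `y` gives an isomorphism
between the fibers. -/
noncomputable def fiberIso {x y : X} (U : CStarMatrix (Fin n) (Fin n) A)
    (h₁ : star U * U = F₁.gramMatrix x) (h₂ : U * star U = F₂.gramMatrix y) :
    IsometricIso (W₁.fiber x) (W₂.fiber y) where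
  toLinearEquiv :=
    { toFun := fun v => (F₂.K y).1 (matrixAct U ((F₁.J x).1 v))
      invFun := fun v => (F₁.K x).1 (matrixAct (star U) ((F₂.J y).1 v))
      map_add' := fun v v' => by rw [map_add, map_add, map_add]
      map_smul' := fun c v => by
        rw [Hom.map_op_smul, map_smul, Hom.map_op_smul, RingHom.id_apply]
      left_inv := fun v => by
        change (F₁.K x).1 (matrixAct (star U) ((F₂.J y).1 ((F₂.K y).1 _))) = v
        rw [← F₂.gramMatrix_act, ← matrixAct_mul _ U, F₂.gramMatrix_mul h₂, ← matrixAct_mul, h₁,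
          F₁.gramMatrix_act_J, F₁.K_J]
      right_inv := fun v => by
        change (F₂.K y).1 (matrixAct U ((F₁.J x).1 ((F₁.K x).1 _))) = v
        rw [← F₁.gramMatrix_act, ← matrixAct_mul U, F₁.mul_gramMatrix h₁, ← matrixAct_mul, h₂,
          F₂.gramMatrix_act_J, F₂.K_J] }
  ip_map v v' := by
    change (W₂.fiber y).ip ((F₂.K y).1 _) ((F₂.K y).1 _) = _
    rw [F₂.ip_K, ← F₂.gramMatrix_act, ← matrixAct_mul, F₂.gramMatrix_mul h₂, ip_matrixAct,
      ← matrixAct_mul, h₁, F₁.gramMatrix_act_J, F₁.ip_J_J]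

/-- The isomorphism of bundles given by a continuous function with values in the partial isometries
between the Gram matrices. -/
noncomputable def iso {U : X → CStarMatrix (Fin n) (Fin n) A} (hU : Continuous U)
    (h₁ : ∀ x, star (U x) * U x = F₁.gramMatrix x)
    (h₂ : ∀ x, U x * star (U x) = F₂.gramMatrix x) : Iso W₁ W₂ where
  fiberEquiv x := (F₁.fiberIso F₂ (U x) (h₁ x) (h₂ x)).toLinearEquiv
  adjointable x := ⟨_, (F₁.fiberIso F₂ (U x) (h₁ x) (h₂ x)).ip_apply_left⟩
  continuous_toFun := by
    rw [continuous_iff_continuousAt]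
    intro q
    have hb := F₁.continuousAt_base (continuousAt_id (x := q))
    exact F₂.continuousAt_K hb (continuous_matrixAct_uncurry.continuousAt.comp
      (f := fun q : W₁.Total => (U q.base, (F₁.J q.base).1 q.vec))
      ((hU.continuousAt.comp (f := fun q : W₁.Total => q.base) hb).prodMk
        (F₁.continuousAt_J continuousAt_id)))
  continuous_invFun := by
    rw [continuous_iff_continuousAt]
    intro q
    have hb := F₂.continuousAt_base (continuousAt_id (x := q))
    exact F₁.continuousAt_K hb (continuous_matrixAct_uncurry.continuousAt.comp
      (f := fun q : W₂.Total => (star (U q.base), (F₂.J q.base).1 q.vec))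
      ((hU.star.continuousAt.comp (f := fun q : W₂.Total => q.base) hb).prodMk
        (F₂.continuousAt_J continuousAt_id)))

theorem iso_isIsometric {U : X → CStarMatrix (Fin n) (Fin n) A} (hU : Continuous U)
    (h₁ : ∀ x, star (U x) * U x = F₁.gramMatrix x)
    (h₂ : ∀ x, U x * star (U x) = F₂.gramMatrix x) : (F₁.iso F₂ hU h₁ h₂).IsIsometric :=
  fun x => (F₁.fiberIso F₂ (U x) (h₁ x) (h₂ x)).ip_map

end Iso

/-- Composing the embedding with a family of partial isometries. -/
noncomputable def transport {U : X → CStarMatrix (Fin n) (Fin n) A} (hU : Continuous U)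
    (h₁ : ∀ x, star (U x) * U x = F.gramMatrix x) : W.Frame n where
  J x := Hom.comp (matHom (U x)) (F.J x)
  K x := Hom.comp (F.K x) (matHom (star (U x)))
  ip_J x v a := by
    change (std A n).ip (matrixAct (U x) ((F.J x).1 v)) a = _
    rw [ip_matrixAct, F.ip_J]
    rfl
  K_J x v := by
    change (F.K x).1 (matrixAct (star (U x)) (matrixAct (U x) ((F.J x).1 v))) = v
    rw [← matrixAct_mul, h₁, F.gramMatrix_act_J, F.K_J]
  continuous_J := by
    have hb : Continuous fun q : W.Total => q.base := continuous_fst.comp F.continuous_J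
    exact hb.prodMk (continuous_matrixAct_uncurry.comp
      ((hU.comp hb).prodMk (continuous_snd.comp F.continuous_J)))
  continuous_K := F.continuous_K.comp (continuous_fst.prodMk (continuous_matrixAct_uncurry.comp
    ((hU.star.comp continuous_fst).prodMk continuous_snd)))

theorem gramMatrix_transport {U : X → CStarMatrix (Fin n) (Fin n) A} (hU : Continuous U)
    (h₁ : ∀ x, star (U x) * U x = F.gramMatrix x) (x : X) :
    (F.transport hU h₁).gramMatrix x = U x * star (U x) := by
  refine matrixAct_injective fun v => ?_
  rw [gramMatrix_act]
  change matrixAct (U x) ((F.J x).1 ((F.K x).1 (matrixAct (star (U x)) v))) = _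
  rw [← gramMatrix_act, ← matrixAct_mul, F.mul_gramMatrix (h₁ x), matrixAct_mul]

section LocalTrivialization

/-- The neighborhood of `x₀` on which the fibers are identified with the fiber at `x₀`. -/
def nearSet (x₀ : X) : Set X :=
  {x | ‖F.gramMatrix x - F.gramMatrix x₀‖ < sqrtRadius (CStarMatrix (Fin n) (Fin n) A)}

theorem isOpen_nearSet (x₀ : X) : IsOpen (F.nearSet x₀) :=
  isOpen_lt (F.continuous_gramMatrix.sub continuous_const).norm continuous_const

theorem mem_nearSet_self (x₀ : X) : x₀ ∈ F.nearSet x₀ := by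
  simp only [nearSet, Set.mem_ofPred_eq, sub_self, norm_zero]
  exact sqrtRadius_pos _

/-- The partial isometry from the fiber at `x` to the fiber at `x₀`, on `nearSet x₀`. -/
noncomputable def alignAt (x₀ x : X) : CStarMatrix (Fin n) (Fin n) A :=
  align (F.gramMatrix x) (F.gramMatrix x₀)

theorem alignAt_spec {x₀ x : X} (hx : x ∈ F.nearSet x₀) :
    star (F.alignAt x₀ x) * F.alignAt x₀ x = F.gramMatrix x ∧
      F.alignAt x₀ x * star (F.alignAt x₀ x) = F.gramMatrix x₀ :=
  align_spec (F.isStarProjection_gramMatrix x) (F.isStarProjection_gramMatrix x₀)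
    (lt_of_lt_of_le hx (sqrtRadius_le_one _))

theorem continuousOn_alignAt (x₀ : X) : ContinuousOn (F.alignAt x₀) (F.nearSet x₀) :=
  continuousOn_align F.continuous_gramMatrix.continuousOn continuousOn_const
    (fun x _ => F.isStarProjection_gramMatrix x) (fun _ _ => F.isStarProjection_gramMatrix x₀)
    fun _ hx => lt_of_lt_of_le hx (sqrtRadius_le_one _)

/-- The local trivialization around `x₀` defined by a frame. -/
noncomputable def localTriv (x₀ : X) : W.LocalTrivialization where
  model := W.fiber x₀
  triv :=
    { toFun := fun q =>
        (q.base, (F.K x₀).1 (matrixAct (F.alignAt x₀ q.base) ((F.J q.base).1 q.vec)))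
      invFun := fun p =>
        ⟨p.1, (F.K p.1).1 (matrixAct (star (F.alignAt x₀ p.1)) ((F.J x₀).1 p.2))⟩
      source := W.proj ⁻¹' F.nearSet x₀
      target := F.nearSet x₀ ×ˢ Set.univ
      map_source' := fun q hq => ⟨hq, Set.mem_univ _⟩
      map_target' := fun p hp => hp.1
      left_inv' := fun q hq => by
        obtain ⟨x, v⟩ := q
        have h := F.alignAt_spec (x₀ := x₀) (x := x) hq
        exact congrArg (FiberTotal.mk x)
          ((F.fiberIso F (F.alignAt x₀ x) h.1 h.2).toLinearEquiv.left_inv v)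
      right_inv' := fun p hp => by
        obtain ⟨x, v⟩ := p
        have h := F.alignAt_spec (x₀ := x₀) (x := x) hp.1
        exact congrArg (Prod.mk x)
          ((F.fiberIso F (F.alignAt x₀ x) h.1 h.2).toLinearEquiv.right_inv v)
      open_source := (F.isOpen_nearSet x₀).preimage (continuous_fst.comp F.continuous_J)
      open_target := (F.isOpen_nearSet x₀).prod isOpen_univ
      continuousOn_toFun := fun q hq => by
        have hb := F.continuousAt_base (continuousAt_id (x := q))
        have hU : ContinuousAt (fun q : W.Total => F.alignAt x₀ q.base) q :=
          ContinuousAt.comp (f := fun q : W.Total => q.base)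
            ((F.continuousOn_alignAt x₀).continuousAt ((F.isOpen_nearSet x₀).mem_nhds hq)) hb
        refine (hb.prodMk ((F.K x₀).1.continuous.continuousAt.comp
          (continuous_matrixAct_uncurry.continuousAt.comp
            (f := fun q : W.Total => (F.alignAt x₀ q.base, (F.J q.base).1 q.vec))
            (hU.prodMk (F.continuousAt_J continuousAt_id))))).continuousWithinAt
      continuousOn_invFun := fun p hp => by
        have hU : ContinuousAt (fun p : X × W.fiber x₀ => star (F.alignAt x₀ p.1)) p :=
          (ContinuousAt.comp (f := fun p : X × W.fiber x₀ => p.1)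
            ((F.continuousOn_alignAt x₀).continuousAt ((F.isOpen_nearSet x₀).mem_nhds hp.1))
            continuousAt_fst).star
        refine (F.continuousAt_K continuousAt_fst (continuous_matrixAct_uncurry.continuousAt.comp
          (f := fun p : X × W.fiber x₀ => (star (F.alignAt x₀ p.1), (F.J x₀).1 p.2))
          (hU.prodMk ((F.J x₀).1.continuous.continuousAt.comp
            continuousAt_snd)))).continuousWithinAt
      baseSet := F.nearSet x₀
      open_baseSet := F.isOpen_nearSet x₀
      source_eq := rfl
      target_eq := rfl
      proj_toFun := fun _ _ => rfl }
  isometric x hx :=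
    have h := F.alignAt_spec (x₀ := x₀) (x := x) hx
    ⟨F.fiberIso F (F.alignAt x₀ x) h.1 h.2, fun _ => rfl⟩

theorem coord_localTriv (x₀ x : X) (v : W.fiber x) :
    (F.localTriv x₀).coord x v = (F.K x₀).1 (matrixAct (F.alignAt x₀ x) ((F.J x).1 v)) := rfl

theorem isBundle (F : W.Frame n) : W.IsBundle := fun x => ⟨F.localTriv x, F.mem_nearSet_self x⟩

end LocalTrivialization

section Smooth

variable {E : Type*} [NormedAddCommGroup E] [NormedSpace ℝ E] {H : Type*} [TopologicalSpace H]
  {I : ModelWithCorners ℝ E H} [ChartedSpace H X]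

/-- The embedding and its adjoint are smooth. -/
def IsSmooth (S : SmoothStructure I W) : Prop :=
  IsSmoothMap S (trivialSmooth I X (std A n)) (fun x => (F.J x).1) ∧
    IsSmoothMap (trivialSmooth I X (std A n)) S (fun x => (F.K x).1)

theorem contMDiffOn_alignAt (h : ContMDiff I 𝓘(ℝ, CStarMatrix (Fin n) (Fin n) A) ∞ F.gramMatrix)
    (x₀ : X) :
    ContMDiffOn I 𝓘(ℝ, CStarMatrix (Fin n) (Fin n) A) ∞ (F.alignAt x₀) (F.nearSet x₀) :=
  contMDiffOn_align h.contMDiffOn contMDiffOn_const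
    (fun x _ => F.isStarProjection_gramMatrix x) (fun _ _ => F.isStarProjection_gramMatrix x₀)
    fun _ hx => hx

theorem contMDiffOn_matHom {U : X → CStarMatrix (Fin n) (Fin n) A} {s : Set X}
    (hU : ContMDiffOn I 𝓘(ℝ, CStarMatrix (Fin n) (Fin n) A) ∞ U s) :
    ContMDiffOn I 𝓘(ℝ, Hom (std A n) (std A n)) ∞ (fun x => matHom (U x)) s :=
  contDiff_matHom.contMDiff.comp_contMDiffOn hU

/-- The smooth structure defined by a frame with smooth Gram matrix. -/
noncomputable def smoothStructure
    (h : ContMDiff I 𝓘(ℝ, CStarMatrix (Fin n) (Fin n) A) ∞ F.gramMatrix) :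
    SmoothStructure I W where
  atlas := Set.range F.localTriv
  exists_mem x := ⟨_, ⟨x, rfl⟩, F.mem_nearSet_self x⟩
  smooth_transition := by
    rintro _ ⟨x₁, rfl⟩ _ ⟨x₂, rfl⟩
    refine ⟨fun x => Hom.comp (F.K x₂) (Hom.comp (matHom (F.alignAt x₂ x))
      (Hom.comp (matHom (star (F.alignAt x₁ x))) (F.J x₁))), ?_, fun x hx v => ?_⟩
    · refine Hom.contMDiffOn_comp contMDiffOn_const (Hom.contMDiffOn_comp (contMDiffOn_matHom
        ((F.contMDiffOn_alignAt h x₂).mono fun x hx => hx.2)) (Hom.contMDiffOn_comp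
        (contMDiffOn_matHom (contMDiffOn_star'
          ((F.contMDiffOn_alignAt h x₁).mono fun x hx => hx.1))) contMDiffOn_const))
    · have h₁ := F.alignAt_spec (x₀ := x₁) (x := x) hx.1
      rw [coord_localTriv, coord_localTriv]
      change (F.K x₂).1 (matrixAct _ (matrixAct _ ((F.J x₁).1 ((F.K x₁).1 _)))) = _
      rw [← F.gramMatrix_act, ← matrixAct_mul _ (F.alignAt x₁ x), F.gramMatrix_mul h₁.2,
        ← matrixAct_mul (star _), h₁.1, F.gramMatrix_act_J]

theorem isSmooth_smoothStructure
    (h : ContMDiff I 𝓘(ℝ, CStarMatrix (Fin n) (Fin n) A) ∞ F.gramMatrix) :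
    F.IsSmooth (F.smoothStructure h) := by
  constructor
  · rintro _ ⟨x₁, rfl⟩ _ rfl
    refine ⟨fun x => Hom.comp (matHom (star (F.alignAt x₁ x))) (F.J x₁), ?_, fun x hx v => ?_⟩
    · exact Hom.contMDiffOn_comp (contMDiffOn_matHom (contMDiffOn_star'
        ((F.contMDiffOn_alignAt h x₁).mono fun x hx => hx.1))) contMDiffOn_const
    · have h₁ := F.alignAt_spec (x₀ := x₁) (x := x) hx.1
      rw [coord_localTriv]
      change matrixAct _ ((F.J x₁).1 ((F.K x₁).1 _)) = (F.J x).1 v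
      rw [← F.gramMatrix_act, ← matrixAct_mul _ (F.alignAt x₁ x), F.gramMatrix_mul h₁.2,
        ← matrixAct_mul (star _), h₁.1, F.gramMatrix_act_J]
  · rintro _ rfl _ ⟨x₁, rfl⟩
    refine ⟨fun x => Hom.comp (F.K x₁) (matHom (F.alignAt x₁ x)), ?_, fun x hx v => ?_⟩
    · exact Hom.contMDiffOn_comp contMDiffOn_const (contMDiffOn_matHom
        ((F.contMDiffOn_alignAt h x₁).mono fun x hx => hx.2))
    · have h₁ := F.alignAt_spec (x₀ := x₁) (x := x) hx.2
      have e : ∀ v : std A n, (F.K x₁).1 (matrixAct (F.alignAt x₁ x) v) =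
          (F.K x₁).1 (matrixAct (F.alignAt x₁ x) ((F.J x).1 ((F.K x).1 v))) := fun v => by
        rw [← F.gramMatrix_act, ← matrixAct_mul, F.mul_gramMatrix h₁.1]
      exact e v

theorem IsSmooth.contMDiff_gramMatrix {F : W.Frame n} {S : SmoothStructure I W}
    (h : F.IsSmooth S) : ContMDiff I 𝓘(ℝ, CStarMatrix (Fin n) (Fin n) A) ∞ F.gramMatrix := by
  obtain ⟨g, hg, hgf⟩ : ∃ g : X → Hom (std A n) (std A n),
      ContMDiffOn I 𝓘(ℝ, Hom (std A n) (std A n)) ∞ g (Set.univ ∩ Set.univ) ∧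
      ∀ x ∈ (Set.univ ∩ Set.univ : Set X), ∀ v : std A n,
        (g x).1 v = (F.J x).1 ((F.K x).1 v) := h.1.comp h.2 _ rfl _ rfl
  have hg' : ContMDiff I 𝓘(ℝ, Hom (std A n) (std A n)) ∞ g := by
    rw [← contMDiffOn_univ]
    exact hg.mono fun x _ => ⟨Set.mem_univ _, Set.mem_univ _⟩
  have : F.gramMatrix = fun x => toMat (g x).1 := by
    funext x
    refine congrArg toMat (funext fun a => ?_)
    exact (hgf x ⟨Set.mem_univ _, Set.mem_univ _⟩ a).symm
  rw [this]
  exact contDiff_toMat.contMDiff.comp hg'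

theorem isSmooth_iso {W₁ : HilbertModuleFamily.{u, v, w₁} A X}
    {W₂ : HilbertModuleFamily.{u, v, w₂} A X} {F₁ : W₁.Frame n} {F₂ : W₂.Frame n}
    {S₁ : SmoothStructure I W₁} {S₂ : SmoothStructure I W₂} (hF₁ : F₁.IsSmooth S₁)
    (hF₂ : F₂.IsSmooth S₂) {U : X → CStarMatrix (Fin n) (Fin n) A}
    (hU : ContMDiff I 𝓘(ℝ, CStarMatrix (Fin n) (Fin n) A) ∞ U)
    (h₁ : ∀ x, star (U x) * U x = F₁.gramMatrix x)
    (h₂ : ∀ x, U x * star (U x) = F₂.gramMatrix x) :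
    (F₁.iso F₂ hU.continuous h₁ h₂).IsSmooth S₁ S₂ := by
  have hm : ∀ {U : X → CStarMatrix (Fin n) (Fin n) A},
      ContMDiff I 𝓘(ℝ, CStarMatrix (Fin n) (Fin n) A) ∞ U →
      IsSmoothMap (trivialSmooth I X (std A n)) (trivialSmooth I X (std A n))
        (fun x v => (matHom (U x)).1 v) := fun hU =>
    isSmoothMap_trivial (contMDiffOn_univ.1 (contMDiffOn_matHom hU.contMDiffOn))
  have hUs : ContMDiff I 𝓘(ℝ, CStarMatrix (Fin n) (Fin n) A) ∞ fun x => star (U x) :=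
    contMDiffOn_univ.1 (contMDiffOn_star' hU.contMDiffOn)
  exact ⟨hF₂.2.comp ((hm hU).comp hF₁.1), hF₁.2.comp ((hm hUs).comp hF₂.1)⟩

end Smooth

end Frame

end HilbertModuleFamily

section SquarePartition

variable {X : Type*} [TopologicalSpace X] {ι : Type*} [Fintype ι]

theorem sum_sq_pos_of_sum_eq_one {f : ι → ℝ} (h : ∑ i, f i = 1) : 0 < ∑ i, f i ^ 2 := by
  refine (Finset.sum_nonneg fun i _ => sq_nonneg (f i)).lt_of_ne fun h0 => ?_
  have := (Finset.sum_eq_zero_iff_of_nonneg fun i _ => sq_nonneg (f i)).1 h0.symm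
  have h1 : ∑ i, f i = 0 := Finset.sum_eq_zero fun i hi => by simpa using this i hi
  exact zero_ne_one (h1.symm.trans h)

theorem sum_sq_div_sqrt {f : ι → ℝ} (h : ∑ i, f i = 1) :
    ∑ i, (f i / √(∑ j, f j ^ 2)) ^ 2 = 1 := by
  have h0 := sum_sq_pos_of_sum_eq_one h
  simp only [div_pow, Real.sq_sqrt h0.le, ← Finset.sum_div]
  exact div_self h0.ne'

theorem tsupport_div_subset {f g : X → ℝ} : tsupport (fun x => f x / g x) ⊆ tsupport f :=
  closure_mono fun x hx => by
    rw [Function.mem_support] at hx ⊢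
    exact fun h => hx (by rw [h, zero_div])

variable [CompactSpace X] [T2Space X]

theorem exists_continuous_sum_sq_eq_one {U : ι → Set X} (hU : ∀ i, IsOpen (U i))
    (hc : ∀ x, ∃ i, x ∈ U i) :
    ∃ ρ : ι → X → ℝ, (∀ i, Continuous (ρ i)) ∧ (∀ i, tsupport (ρ i) ⊆ U i) ∧
      ∀ x, ∑ i, ρ i x ^ 2 = 1 := by
  obtain ⟨f, hf⟩ := PartitionOfUnity.exists_isSubordinate isClosed_univ U hU
    fun x _ => Set.mem_iUnion.2 (hc x)
  have hs : ∀ x, ∑ i, f i x = 1 := fun x => by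
    rw [← f.sum_eq_one (Set.mem_univ x), finsum_eq_sum_of_fintype]
  refine ⟨fun i x => f i x / √(∑ j, f j x ^ 2), fun i => ?_,
    fun i => tsupport_div_subset.trans (hf i), fun x => sum_sq_div_sqrt (hs x)⟩
  refine (f i).continuous.div ?_ fun x => (Real.sqrt_pos.2 (sum_sq_pos_of_sum_eq_one (hs x))).ne'
  exact (continuous_finsetSum _ fun j _ => (f j).continuous.pow 2).sqrt

theorem exists_contMDiff_sum_sq_eq_one {E : Type*} [NormedAddCommGroup E] [NormedSpace ℝ E]
    [FiniteDimensional ℝ E] {H : Type*} [TopologicalSpace H] (I : ModelWithCorners ℝ E H)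
    [ChartedSpace H X] [IsManifold I ∞ X] {U : ι → Set X} (hU : ∀ i, IsOpen (U i))
    (hc : ∀ x, ∃ i, x ∈ U i) :
    ∃ ρ : ι → X → ℝ, (∀ i, ContMDiff I 𝓘(ℝ, ℝ) ∞ (ρ i)) ∧ (∀ i, tsupport (ρ i) ⊆ U i) ∧
      ∀ x, ∑ i, ρ i x ^ 2 = 1 := by
  obtain ⟨f, hf⟩ := SmoothPartitionOfUnity.exists_isSubordinate I isClosed_univ U hU
    fun x _ => Set.mem_iUnion.2 (hc x)
  have hs : ∀ x, ∑ i, f i x = 1 := fun x => by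
    rw [← f.sum_eq_one (Set.mem_univ x), finsum_eq_sum_of_fintype]
  refine ⟨fun i x => f i x / √(∑ j, f j x ^ 2), fun i => ?_,
    fun i => tsupport_div_subset.trans (hf i), fun x => sum_sq_div_sqrt (hs x)⟩
  have h1 : ContMDiff I 𝓘(ℝ, ℝ) ∞ fun x => ∑ j, f j x ^ 2 :=
    contMDiff_finsetSum fun j _ => (contDiff_id.pow 2).contMDiff.comp (f j).contMDiff
  have h2 : ContMDiff I 𝓘(ℝ, ℝ) ∞ fun x => √(∑ j, f j x ^ 2) := fun x =>
    (Real.contDiffAt_sqrt (sum_sq_pos_of_sum_eq_one (hs x)).ne').contMDiffAt.comp x (h1 x)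
  exact (f i).contMDiff.div₀ h2 fun x =>
    (Real.sqrt_pos.2 (sum_sq_pos_of_sum_eq_one (hs x))).ne'

end SquarePartition

namespace HilbertModule

variable {A : Type u} [CStarAlgebra A] [PartialOrder A] [StarOrderedRing A]

section Blocks

variable {n N : ℕ}

theorem stdBasis_apply_self (j : Fin n) : stdBasis (A := A) n j j = 1 := Pi.single_eq_same j 1

theorem stdBasis_apply_of_ne {i j : Fin n} (h : i ≠ j) : stdBasis (A := A) n j i = 0 :=
  Pi.single_eq_of_ne h 1

theorem ip_stdBasis_left (j : Fin n) (v : std A n) :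
    (std A n).ip (stdBasis n j) v = unop (v j) := by
  rw [std_ip, Finset.sum_eq_single j]
  · change star (unop ((Pi.single j 1 : Fin n → Aᵐᵒᵖ) j)) * _ = _
    simp
  · intro i _ hi
    change star (unop ((Pi.single j 1 : Fin n → Aᵐᵒᵖ) i)) * _ = _
    simp [hi]
  · simp

/-- The coordinates of a vector along an embedding of index sets. -/
def restrictCoord (φ : Fin n ↪ Fin N) (a : std A N) : std A n :=
  (WithCStarModule.equiv Aᵐᵒᵖ (Fin n → Aᵐᵒᵖ)).symm fun k => a (φ k)

/-- Extension by zero along an embedding of index sets. -/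
noncomputable def extendCoord (φ : Fin n ↪ Fin N) (a : std A n) : std A N :=
  ∑ k, a k • stdBasis N (φ k)

theorem ip_extendCoord (φ : Fin n ↪ Fin N) (a : std A n) (b : std A N) :
    (std A N).ip (extendCoord φ a) b = (std A n).ip a (restrictCoord φ b) := by
  rw [extendCoord, ip_sum_left, std_ip]
  refine Finset.sum_congr rfl fun k _ => ?_
  rw [ip_smul_left_op, ip_stdBasis_left]
  rfl

theorem extendCoord_apply (φ : Fin n ↪ Fin N) (a : std A n) (i : Fin N) :
    extendCoord φ a i = ∑ k, a k * stdBasis N (φ k) i :=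
  Finset.sum_apply i Finset.univ fun k => (a k • stdBasis N (φ k) : Fin N → Aᵐᵒᵖ)

theorem restrictCoord_extendCoord (φ : Fin n ↪ Fin N) (a : std A n) :
    restrictCoord φ (extendCoord φ a) = a := by
  refine std_ext fun l => ?_
  change extendCoord φ a (φ l) = a l
  rw [extendCoord_apply, Finset.sum_eq_single l]
  · rw [stdBasis_apply_self, mul_one]
  · intro k _ hk
    rw [stdBasis_apply_of_ne (φ.injective.ne hk.symm), mul_zero]
  · simp

theorem restrictCoord_extendCoord_of_disjoint {m : ℕ} (φ : Fin n ↪ Fin N) (ψ : Fin m ↪ Fin N)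
    (h : ∀ k l, φ k ≠ ψ l) (a : std A m) : restrictCoord φ (extendCoord ψ a) = 0 := by
  refine std_ext fun l => ?_
  change extendCoord ψ a (φ l) = 0
  rw [extendCoord_apply]
  exact Finset.sum_eq_zero fun k _ => by rw [stdBasis_apply_of_ne (h l k), mul_zero]

end Blocks

theorem IsFGP.exists_embedding {V : HilbertModule.{u, w} A} (h : V.IsFGP) :
    ∃ (n : ℕ) (C : V → std A n) (C' : std A n → V),
      (∀ v a, (std A n).ip (C v) a = V.ip v (C' a)) ∧ ∀ v, C' (C v) = v := by
  obtain ⟨n, W, ⟨φ⟩⟩ := h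
  refine ⟨n, fun v => φ.toLinearEquiv (V.prodMk W v 0),
    fun a => V.prodFst W (φ.toLinearEquiv.symm a), fun v a => ?_, fun v => ?_⟩
  · rw [φ.ip_apply_left]
    change V.ip v _ + W.ip 0 _ = _
    rw [ip_zero_left, add_zero]
    rfl
  · exact congrArg (V.prodFst W) (φ.toLinearEquiv.symm_apply_apply _)

theorem IsFGP.of_isometricIso {V : HilbertModule.{u, w} A} {V' : HilbertModule.{u, w'} A}
    (h : V.IsFGP) (f : IsometricIso V V') : V'.IsFGP := by
  obtain ⟨n, W, ⟨φ⟩⟩ := h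
  refine ⟨n, W, ⟨⟨(LinearEquiv.prodCongr f.symm.toLinearEquiv (LinearEquiv.refl Aᵐᵒᵖ W)).trans
    φ.toLinearEquiv, fun z z' => ?_⟩⟩⟩
  refine (φ.ip_map _ _).trans ?_
  exact congrArg₂ (· + ·) (f.symm.ip_map z.1 z'.1) rfl

/-- Finitely many finitely generated projective modules embed in some `Aᴺ` with mutually orthogonal
images. -/
theorem exists_orthogonal_embeddings {ι : Type*} [Finite ι] {V : ι → HilbertModule.{u, w} A}
    (h : ∀ i, (V i).IsFGP) :
    ∃ N₀ : ℕ, ∀ N ≥ N₀, ∃ (B : ∀ i, Hom (V i) (std A N)) (B' : ∀ i, Hom (std A N) (V i)),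
      (∀ i v a, (std A N).ip ((B i).1 v) a = (V i).ip v ((B' i).1 a)) ∧
      (∀ i v, (B' i).1 ((B i).1 v) = v) ∧ ∀ i j, i ≠ j → ∀ v, (B' i).1 ((B j).1 v) = 0 := by
  have := Fintype.ofFinite ι
  choose n C C' hC hC' using fun i => (h i).exists_embedding
  refine ⟨Fintype.card (Σ i, Fin (n i)), fun N hN => ?_⟩
  obtain ⟨emb⟩ : Nonempty ((Σ i, Fin (n i)) ↪ Fin N) :=
    Function.Embedding.nonempty_of_card_le (by simpa using hN)
  let φ : ∀ i, Fin (n i) ↪ Fin N := fun i => (Function.Embedding.sigmaMk i).trans emb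
  have hφ : ∀ i j, i ≠ j → ∀ k l, φ i k ≠ φ j l := fun i j hij k l h =>
    hij (congrArg Sigma.fst (emb.injective h))
  have hadj : ∀ i v a, (std A N).ip (extendCoord (φ i) (C i v)) a =
      (V i).ip v (C' i (restrictCoord (φ i) a)) := fun i v a => by
    rw [ip_extendCoord, hC]
  refine ⟨fun i => Hom.ofAdjoint _ _ (hadj i), fun i => Hom.ofAdjoint
    (fun a => C' i (restrictCoord (φ i) a)) (fun v => extendCoord (φ i) (C i v)) fun a v => ?_,
    hadj, fun i v => ?_, fun i j hij v => ?_⟩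
  · rw [← (V i).star_ip, ← hadj, star_ip]
  · change C' i (restrictCoord (φ i) (extendCoord (φ i) (C i v))) = v
    rw [restrictCoord_extendCoord, hC']
  · change C' i (restrictCoord (φ i) (extendCoord (φ j) (C j v))) = 0
    rw [restrictCoord_extendCoord_of_disjoint _ _ (hφ i j hij)]
    refine (V i).ip_ext fun z => ?_
    rw [← star_ip, ← hC, ip_zero_right, ip_zero_left, star_zero]

end HilbertModule

namespace HilbertModuleFamily

open HilbertModule Filter Topology

variable {A : Type u} [CStarAlgebra A] [PartialOrder A] [StarOrderedRing A] {X : Type v}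
  [TopologicalSpace X]

namespace LocalTrivialization

variable {W : HilbertModuleFamily.{u, v, w} A X} (e : W.LocalTrivialization)

open Classical in
/-- The inverse of the fiber coordinate, extended by zero outside the base set. -/
noncomputable def symmCoord (x : X) (v : e.model) : W.fiber x :=
  if hx : x ∈ e.triv.baseSet then (e.fiberIso hx).toLinearEquiv.symm v else 0

theorem symmCoord_eq {x : X} (hx : x ∈ e.triv.baseSet) (v : e.model) :
    e.symmCoord x v = (e.fiberIso hx).toLinearEquiv.symm v := dif_pos hx

theorem coord_symmCoord {x : X} (hx : x ∈ e.triv.baseSet) (v : e.model) :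
    e.coord x (e.symmCoord x v) = v := by
  rw [symmCoord_eq e hx, coord_fiberIso_symm]

theorem symmCoord_coord {x : X} (hx : x ∈ e.triv.baseSet) (v : W.fiber x) :
    e.symmCoord x (e.coord x v) = v :=
  e.coord_injective hx (e.coord_symmCoord hx _)

theorem ip_coord {x : X} (hx : x ∈ e.triv.baseSet) (v : W.fiber x) (m : e.model) :
    e.model.ip (e.coord x v) m = (W.fiber x).ip v (e.symmCoord x m) := by
  rw [symmCoord_eq e hx, ← e.fiberIso_apply hx, IsometricIso.ip_apply_left]

theorem continuousAt_symmCoord {Y : Type*} [TopologicalSpace Y] {b : Y → X} {f : Y → e.model}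
    {y : Y} (hb : ContinuousAt b y) (hy : b y ∈ e.triv.baseSet) (hf : ContinuousAt f y) :
    ContinuousAt (fun z => (⟨b z, e.symmCoord (b z) (f z)⟩ : W.Total)) y := by
  refine e.continuousAt_total hb hy (hf.congr ?_)
  filter_upwards [hb.eventually (e.triv.open_baseSet.mem_nhds hy)] with z hz
  exact (e.coord_symmCoord hz _).symm

end LocalTrivialization

variable {W : HilbertModuleFamily.{u, v, w} A X}

theorem real_smul_map {V : HilbertModule.{u, w} A} {V' : HilbertModule.{u, w'} A} (T : Hom V V')
    (c : ℝ) (v : V) : T.1 (c • v) = c • T.1 v := (T.1.restrictScalars ℝ).map_smul c v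

theorem symmCoord_real_smul (e : W.LocalTrivialization) {x : X} (hx : x ∈ e.triv.baseSet) (c : ℝ)
    (v : e.model) : e.symmCoord x (c • v) = c • e.symmCoord x v := by
  rw [e.symmCoord_eq hx, e.symmCoord_eq hx]
  exact real_smul_map (e.fiberIso hx).symm.toHom c v

section Glue

universe w₁

variable {ι : Type*} {V : HilbertModule.{u, w₁} A} {e : ι → W.LocalTrivialization} {ρ : ι → X → ℝ}
  {B : ∀ i, Hom (e i).model V} {B' : ∀ i, Hom V (e i).model}

theorem mem_baseSet_of_ne_zero (hρ : ∀ i, tsupport (ρ i) ⊆ (e i).triv.baseSet) {i : ι} {x : X}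
    (h : ρ i x ≠ 0) : x ∈ (e i).triv.baseSet := hρ i (subset_tsupport _ h)

theorem eventually_eq_zero_of_notMem_tsupport {f : X → ℝ} {x : X} (h : x ∉ tsupport f) :
    ∀ᶠ y in 𝓝 x, f y = 0 := notMem_tsupport_iff_eventuallyEq.1 h

variable [Fintype ι]

/-- The sum of the local embeddings `B i ∘ e i`, weighted by `ρ i`. -/
noncomputable def glue (ρ : ι → X → ℝ) (B : ∀ i, Hom (e i).model V) (x : X) (v : W.fiber x) : V :=
  ∑ i, ρ i x • (B i).1 ((e i).coord x v)

/-- The sum of the local projections `(e i)⁻¹ ∘ B' i`, weighted by `ρ i`. -/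
noncomputable def coglue (ρ : ι → X → ℝ) (B' : ∀ i, Hom V (e i).model) (x : X) (a : V) :
    W.fiber x :=
  ∑ i, ρ i x • (e i).symmCoord x ((B' i).1 a)

theorem ip_glue (hρ : ∀ i, tsupport (ρ i) ⊆ (e i).triv.baseSet)
    (hB : ∀ i v a, V.ip ((B i).1 v) a = (e i).model.ip v ((B' i).1 a))
    (x : X) (v : W.fiber x) (a : V) :
    V.ip (glue ρ B x v) a = (W.fiber x).ip v (coglue ρ B' x a) := by
  rw [glue, coglue, ip_sum_left, ip_sum_right]
  refine Finset.sum_congr rfl fun i _ => ?_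
  rw [ip_real_smul_left, ip_real_smul_right]
  by_cases h : ρ i x = 0
  · rw [h, zero_smul, zero_smul]
  · rw [hB, (e i).ip_coord (mem_baseSet_of_ne_zero hρ h)]

theorem coglue_glue (hρ : ∀ i, tsupport (ρ i) ⊆ (e i).triv.baseSet)
    (hsum : ∀ x, ∑ i, ρ i x ^ 2 = 1) (hBB : ∀ i v, (B' i).1 ((B i).1 v) = v)
    (hBB' : ∀ i j, i ≠ j → ∀ v, (B' i).1 ((B j).1 v) = 0) (x : X) (v : W.fiber x) :
    coglue ρ B' x (glue ρ B x v) = v := by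
  have h : ∀ i, ρ i x • (e i).symmCoord x ((B' i).1 (∑ j, ρ j x • (B j).1 ((e j).coord x v))) =
      ρ i x ^ 2 • v := fun i => by
    by_cases h : ρ i x = 0
    · rw [h]; simp
    · have hx := mem_baseSet_of_ne_zero hρ h
      rw [map_sum, Finset.sum_eq_single i, real_smul_map, hBB, symmCoord_real_smul _ hx,
        (e i).symmCoord_coord hx, smul_smul, sq]
      · intro j _ hj
        rw [real_smul_map, hBB' i j hj.symm, smul_zero]
      · simp
  rw [coglue, glue, Finset.sum_congr rfl fun i _ => h i, ← Finset.sum_smul, hsum, one_smul]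

theorem continuous_glue (hW : W.IsBundle) (hρc : ∀ i, Continuous (ρ i))
    (hρ : ∀ i, tsupport (ρ i) ⊆ (e i).triv.baseSet) :
    Continuous fun q : W.Total => glue ρ B q.base q.vec := by
  have hb : Continuous fun q : W.Total => q.base := hW.continuous_proj
  refine continuous_finsetSum _ fun i _ => ?_
  rw [continuous_iff_continuousAt]
  intro q
  by_cases h : q.base ∈ tsupport (ρ i)
  · exact ((hρc i).continuousAt.comp (f := fun q : W.Total => q.base) hb.continuousAt).smul
      ((B i).1.continuous.continuousAt.comp
        ((e i).continuousAt_coord (f := fun q => q) continuousAt_id (hρ i h)))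
  · refine continuousAt_const.congr (f := fun _ => (0 : V)) ?_
    filter_upwards [hb.continuousAt.eventually (eventually_eq_zero_of_notMem_tsupport h)]
      with q hq
    rw [hq, zero_smul]

theorem continuous_coglue (hW : W.IsBundle) (hρc : ∀ i, Continuous (ρ i))
    (hρ : ∀ i, tsupport (ρ i) ⊆ (e i).triv.baseSet) :
    Continuous fun q : X × V => (⟨q.1, coglue ρ B' q.1 q.2⟩ : W.Total) := by
  rw [continuous_iff_continuousAt]
  rintro ⟨x, a⟩
  obtain ⟨e', he'⟩ := hW x
  refine e'.continuousAt_total continuousAt_fst he' ?_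
  have hc : ContinuousAt (fun p : X × V =>
      ∑ i, ρ i p.1 • e'.coord p.1 ((e i).symmCoord p.1 ((B' i).1 p.2))) (x, a) := by
    refine tendsto_finsetSum _ fun i _ => ?_
    by_cases h : x ∈ tsupport (ρ i)
    · have h1 := (e i).continuousAt_symmCoord (b := fun p : X × V => p.1)
        (f := fun p => (B' i).1 p.2) (y := (x, a)) continuousAt_fst (hρ i h)
        ((B' i).1.continuous.continuousAt.comp continuousAt_snd)
      exact ((hρc i).continuousAt.comp (f := fun p : X × V => p.1) continuousAt_fst).smul
        (e'.continuousAt_coord h1 he')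
    · have : ContinuousAt (fun p : X × V =>
          ρ i p.1 • e'.coord p.1 ((e i).symmCoord p.1 ((B' i).1 p.2))) (x, a) := by
        refine continuousAt_const.congr (f := fun _ => (0 : e'.model)) ?_
        filter_upwards [(continuousAt_fst (p := (x, a))).eventually
          (eventually_eq_zero_of_notMem_tsupport h)] with p hp
        rw [hp, zero_smul]
      exact this
  refine hc.congr ?_
  filter_upwards [(continuousAt_fst (p := (x, a))).eventually
    (e'.triv.open_baseSet.mem_nhds he')] with p hp
  rw [coglue, ← e'.fiberIso_apply hp, map_sum]
  refine Finset.sum_congr rfl fun i _ => ?_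
  rw [← e'.fiberIso_apply hp]
  exact (real_smul_map (e'.fiberIso hp).toHom _ _).symm

variable {E : Type*} [NormedAddCommGroup E] [NormedSpace ℝ E] {H : Type*} [TopologicalSpace H]
  {I : ModelWithCorners ℝ E H} [ChartedSpace H X]

theorem contMDiffOn_real_smul {F : Type*} [NormedAddCommGroup F] [NormedSpace ℝ F] {r : X → ℝ}
    {g : X → F} {s : Set X} (hr : ContMDiffOn I 𝓘(ℝ, ℝ) ∞ r s) (hg : ContMDiffOn I 𝓘(ℝ, F) ∞ g s) :
    ContMDiffOn I 𝓘(ℝ, F) ∞ (fun x => r x • g x) s :=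
  (contDiff_smul : ContDiff ℝ ∞ fun p : ℝ × F => p.1 • p.2).contMDiff.comp_contMDiffOn
    (hr.prodMk_space hg)

theorem isSmoothMap_glue {S : SmoothStructure I W} (hρs : ∀ i, ContMDiff I 𝓘(ℝ, ℝ) ∞ (ρ i))
    (hρ : ∀ i, tsupport (ρ i) ⊆ (e i).triv.baseSet) (he : ∀ i, e i ∈ S.atlas) :
    IsSmoothMap S (trivialSmooth I X V) fun x v => glue ρ B x v := by
  rintro e' he' _ rfl
  refine SmoothInCoords.sum (s := Finset.univ) (W₂ := trivial X V)
    (f := fun i x v => ρ i x • (B i).1 ((e i).coord x v)) fun i _ => ?_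
  refine smoothInCoords_of_local fun x hx => ?_
  by_cases h : x ∈ tsupport (ρ i)
  · obtain ⟨g, hg, hgf⟩ := S.smooth_transition e' he' (e i) (he i)
    refine ⟨e'.triv.baseSet ∩ (e i).triv.baseSet,
      (e'.triv.open_baseSet.inter (e i).triv.open_baseSet).mem_nhds ⟨hx.1, hρ i h⟩,
      fun x => ρ i x • Hom.comp (B i) (g x), contMDiffOn_real_smul (hρs i).contMDiffOn
        (Hom.contMDiffOn_comp contMDiffOn_const hg), fun y hy _ v => ?_⟩
    exact congrArg (fun z => ρ i y • (B i).1 z) (hgf y hy v)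
  · refine ⟨_, eventually_eq_zero_of_notMem_tsupport h, fun _ => 0, contMDiffOn_const,
      fun y hy _ v => ?_⟩
    have hy : ρ i y = 0 := hy
    change (0 : V) = ρ i y • (B i).1 ((e i).coord y v)
    rw [hy, zero_smul]

theorem isSmoothMap_coglue {S : SmoothStructure I W} (hρs : ∀ i, ContMDiff I 𝓘(ℝ, ℝ) ∞ (ρ i))
    (hρ : ∀ i, tsupport (ρ i) ⊆ (e i).triv.baseSet) (he : ∀ i, e i ∈ S.atlas) :
    IsSmoothMap (trivialSmooth I X V) S fun x a => coglue ρ B' x a := by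
  rintro _ rfl e' he'
  refine SmoothInCoords.sum (s := Finset.univ) (W₁ := trivial X V)
    (f := fun i x (a : V) => ρ i x • (e i).symmCoord x ((B' i).1 a)) fun i _ => ?_
  refine smoothInCoords_of_local fun x hx => ?_
  by_cases h : x ∈ tsupport (ρ i)
  · obtain ⟨g, hg, hgf⟩ := S.smooth_transition (e i) (he i) e' he'
    refine ⟨(e i).triv.baseSet ∩ e'.triv.baseSet,
      ((e i).triv.open_baseSet.inter e'.triv.open_baseSet).mem_nhds ⟨hρ i h, hx.2⟩,
      fun x => ρ i x • Hom.comp (g x) (B' i), contMDiffOn_real_smul (hρs i).contMDiffOn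
        (Hom.contMDiffOn_comp hg contMDiffOn_const), fun y hy _ v => ?_⟩
    have h1 : ∀ a : V, ρ i y • (g y).1 ((B' i).1 a) =
        e'.coord y (ρ i y • (e i).symmCoord y ((B' i).1 a)) := fun a => by
      have h2 := hgf y hy ((e i).symmCoord y ((B' i).1 a))
      rw [(e i).coord_symmCoord hy.1] at h2
      rw [← e'.fiberIso_apply hy.2]
      refine Eq.trans ?_ (real_smul_map (e'.fiberIso hy.2).toHom _ _).symm
      exact congrArg (fun z => ρ i y • z) (h2.trans (e'.fiberIso_apply hy.2 _).symm)
    exact h1 v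
  · refine ⟨_, eventually_eq_zero_of_notMem_tsupport h, fun _ => 0, contMDiffOn_const,
      fun y hy hy' v => ?_⟩
    have hy : ρ i y = 0 := hy
    have h1 : ∀ a : V,
        (0 : e'.model) = e'.coord y (ρ i y • (e i).symmCoord y ((B' i).1 a)) := fun a => by
      rw [hy, zero_smul, ← e'.fiberIso_apply hy'.2, map_zero]
    exact h1 v

end Glue

/-- The frame obtained by gluing local trivializations with a partition of unity. -/
noncomputable def gluedFrame {ι : Type*} [Fintype ι] {N : ℕ} {e : ι → W.LocalTrivialization}
    {ρ : ι → X → ℝ} {B : ∀ i, Hom (e i).model (std A N)} {B' : ∀ i, Hom (std A N) (e i).model}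
    (hW : W.IsBundle) (hρc : ∀ i, Continuous (ρ i))
    (hρ : ∀ i, tsupport (ρ i) ⊆ (e i).triv.baseSet) (hsum : ∀ x, ∑ i, ρ i x ^ 2 = 1)
    (hB : ∀ i v a, (std A N).ip ((B i).1 v) a = (e i).model.ip v ((B' i).1 a))
    (hBB : ∀ i v, (B' i).1 ((B i).1 v) = v)
    (hBB' : ∀ i j, i ≠ j → ∀ v, (B' i).1 ((B j).1 v) = 0) : W.Frame N where
  J x := Hom.ofAdjoint (glue ρ B x) (coglue ρ B' x) (ip_glue hρ hB x)
  K x := Hom.ofAdjoint (coglue ρ B' x) (glue ρ B x) fun a v => by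
    rw [← (W.fiber x).star_ip, ← ip_glue hρ hB, (std A N).star_ip]
  ip_J := ip_glue hρ hB
  K_J := coglue_glue hρ hsum hBB hBB'
  continuous_J := hW.continuous_proj.prodMk (continuous_glue hW hρc hρ)
  continuous_K := continuous_coglue hW hρc hρ

theorem IsFGPBundle.isFGP_model (hW : W.IsFGPBundle) (e : W.LocalTrivialization) {x : X}
    (hx : x ∈ e.triv.baseSet) : e.model.IsFGP := (hW.2 x).of_isometricIso (e.fiberIso hx)

theorem exists_finite_cover [CompactSpace X] {e : X → W.LocalTrivialization}
    (he : ∀ x, x ∈ (e x).triv.baseSet) :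
    ∃ t : Finset X, ∀ x, ∃ i : t, x ∈ (e i).triv.baseSet := by
  obtain ⟨t, ht⟩ := CompactSpace.elim_nhds_subcover (fun x => (e x).triv.baseSet)
    fun x => (e x).triv.open_baseSet.mem_nhds (he x)
  refine ⟨t, fun x => ?_⟩
  have : x ∈ ⋃ y ∈ t, (e y).triv.baseSet := by rw [ht]; trivial
  obtain ⟨i, hi, hx⟩ := Set.mem_iUnion₂.1 this
  exact ⟨⟨i, hi⟩, hx⟩

variable [CompactSpace X] [T2Space X]

theorem IsFGPBundle.exists_frame (hW : W.IsFGPBundle) :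
    ∃ N₀ : ℕ, ∀ N ≥ N₀, Nonempty (W.Frame N) := by
  choose e he using hW.1
  obtain ⟨t, ht⟩ := exists_finite_cover he
  obtain ⟨ρ, hρc, hρ, hsum⟩ := exists_continuous_sum_sq_eq_one
    (fun i : t => (e i).triv.open_baseSet) ht
  obtain ⟨N₀, hN⟩ := exists_orthogonal_embeddings fun i : t => hW.isFGP_model (e i) (he i)
  refine ⟨N₀, fun N h => ?_⟩
  obtain ⟨B, B', hB, hBB, hBB'⟩ := hN N h
  exact ⟨gluedFrame hW.1 hρc hρ hsum hB hBB hBB'⟩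

theorem IsFGPBundle.exists_isSmooth_frame {E : Type*} [NormedAddCommGroup E] [NormedSpace ℝ E]
    [FiniteDimensional ℝ E] {H : Type*} [TopologicalSpace H] {I : ModelWithCorners ℝ E H}
    [ChartedSpace H X] [IsManifold I ∞ X] (hW : W.IsFGPBundle) (S : SmoothStructure I W) :
    ∃ N₀ : ℕ, ∀ N ≥ N₀, ∃ F : W.Frame N, F.IsSmooth S := by
  choose e heS he using S.exists_mem
  obtain ⟨t, ht⟩ := exists_finite_cover he
  obtain ⟨ρ, hρs, hρ, hsum⟩ := exists_contMDiff_sum_sq_eq_one I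
    (fun i : t => (e i).triv.open_baseSet) ht
  obtain ⟨N₀, hN⟩ := exists_orthogonal_embeddings fun i : t => hW.isFGP_model (e i) (he i)
  refine ⟨N₀, fun N h => ?_⟩
  obtain ⟨B, B', hB, hBB, hBB'⟩ := hN N h
  exact ⟨gluedFrame hW.1 (fun i => (hρs i).continuous) hρ hsum hB hBB hBB',
    isSmoothMap_glue hρs hρ fun i => heS i, isSmoothMap_coglue hρs hρ fun i => heS i⟩

end HilbertModuleFamily

section PartialIsometries

variable {B : Type*} [CStarAlgebra B]

theorem isUnit_star_mul_self_add {t t' p q : B} (hp : IsStarProjection p)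
    (hq : IsStarProjection q) (htp : t * p = t) (hqt : q * t = t) (hpt : p * t' = t')
    (h₁ : t' * t = p) (h₂ : t * t' = q) : IsUnit (star t * t + (1 - p)) := by
  have hps := hp.isSelfAdjoint.star_eq
  have hab : (star t * t + (1 - p)) * (t' * star t' + (1 - p)) = 1 := by
    have e : (star t * t + (1 - p)) * (t' * star t' + (1 - p)) =
        star t * (t * t') * star t' + star t * (t - t * p) + (t' - p * t') * star t' +
          (1 - p - (p - p * p)) := by noncomm_ring
    have e₁ : star t * q = star t := by
      rw [← hq.isSelfAdjoint.star_eq, ← star_mul, hqt]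
    rw [e, h₂, htp, hpt, hp.isIdempotentElem.eq, e₁, ← star_mul, h₁, hps]
    simp
  have hba : (t' * star t' + (1 - p)) * (star t * t + (1 - p)) = 1 := by
    have := congrArg star hab
    simpa [hps] using this
  exact ⟨⟨_, _, hab, hba⟩, rfl⟩

/-- The polar part of an element that is invertible as a map from the range of `p` to the range
of `q`. -/
theorem exists_continuous_partialIsometry {X : Type*} [TopologicalSpace X] {t t' p q : X → B}
    (ht : Continuous t) (hpc : Continuous p)
    (hp : ∀ x, IsStarProjection (p x)) (hq : ∀ x, IsStarProjection (q x))
    (htp : ∀ x, t x * p x = t x) (hqt : ∀ x, q x * t x = t x) (hpt : ∀ x, p x * t' x = t' x)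
    (htq : ∀ x, t' x * q x = t' x) (h₁ : ∀ x, t' x * t x = p x) (h₂ : ∀ x, t x * t' x = q x) :
    ∃ U : X → B, Continuous U ∧ (∀ x, star (U x) * U x = p x) ∧
      ∀ x, U x * star (U x) = q x := by
  have hu₁ : ∀ x, IsUnit (star (t x) * t x + (1 - p x)) := fun x =>
    isUnit_star_mul_self_add (hp x) (hq x) (htp x) (hqt x) (hpt x) (h₁ x) (h₂ x)
  have hu₂ : ∀ x, IsUnit (t x * star (t x) + (1 - q x)) := fun x => by
    have hps := (hp x).isSelfAdjoint.star_eq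
    have hqs := (hq x).isSelfAdjoint.star_eq
    have := isUnit_star_mul_self_add (t := star (t x)) (t' := star (t' x)) (hq x) (hp x)
      (by rw [← hqs, ← star_mul, hqt]) (by rw [← hps, ← star_mul, htp])
      (by rw [← hqs, ← star_mul, htq]) (by rw [← star_mul, h₂, hqs])
      (by rw [← star_mul, h₁, hps])
    rwa [star_star] at this
  have h := fun x => polar_spec (hp x) (hq x) (htp x) (hqt x) (hu₁ x) (hu₂ x)
  refine ⟨fun x => polar (t x) (p x), ?_, fun x => (h x).1, fun x => (h x).2⟩
  rw [← continuousOn_univ]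
  exact continuousOn_polar ht.continuousOn hpc.continuousOn (fun x _ => hp x) fun x _ => hu₁ x

theorem norm_star_mul_self_sub_le_of_norm_le_one {z u : B} (hz : ‖z‖ ≤ 2) (hu : ‖u‖ ≤ 1) :
    ‖star z * z - star u * u‖ ≤ 3 * ‖z - u‖ := by
  have e : star z * z - star u * u = star z * (z - u) + star (z - u) * u := by
    rw [star_sub]; noncomm_ring
  rw [e]
  calc ‖star z * (z - u) + star (z - u) * u‖ ≤ ‖star z‖ * ‖z - u‖ + ‖star (z - u)‖ * ‖u‖ :=
        (norm_add_le _ _).trans (add_le_add (norm_mul_le _ _) (norm_mul_le _ _))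
    _ ≤ 2 * ‖z - u‖ + ‖z - u‖ * 1 := by rw [norm_star, norm_star]; gcongr
    _ = 3 * ‖z - u‖ := by ring

/-- Continuously equivalent smooth families of projections are smoothly equivalent. -/
theorem exists_contMDiff_partialIsometry {E : Type*} [NormedAddCommGroup E] [NormedSpace ℝ E]
    [FiniteDimensional ℝ E] {H : Type*} [TopologicalSpace H] (I : ModelWithCorners ℝ E H)
    {X : Type*} [TopologicalSpace X] [CompactSpace X] [T2Space X] [ChartedSpace H X]
    [IsManifold I ∞ X] {p q U : X → B} (hps : ContMDiff I 𝓘(ℝ, B) ∞ p)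
    (hqs : ContMDiff I 𝓘(ℝ, B) ∞ q) (hp : ∀ x, IsStarProjection (p x))
    (hq : ∀ x, IsStarProjection (q x)) (hU : Continuous U)
    (h₁ : ∀ x, star (U x) * U x = p x) (h₂ : ∀ x, U x * star (U x) = q x) :
    ∃ V : X → B, ContMDiff I 𝓘(ℝ, B) ∞ V ∧ (∀ x, star (V x) * V x = p x) ∧
      ∀ x, V x * star (V x) = q x := by
  have hr := sqrtRadius_pos B
  have hr1 := sqrtRadius_le_one B
  obtain ⟨U', hU's, hU'⟩ := exists_contMDiff_norm_sub_lt I hU (η := sqrtRadius B / 4) (by positivity)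
  set Z : X → B := fun x => q x * U' x * p x with hZ
  have hUn : ∀ x, ‖U x‖ ≤ 1 := fun x => by
    have h := CStarRing.norm_star_mul_self (x := U x)
    rw [h₁] at h
    nlinarith [(hp x).norm_le, norm_nonneg (U x)]
  have hZU : ∀ x, ‖Z x - U x‖ ≤ sqrtRadius B / 4 := fun x => by
    have e : Z x - U x = q x * (U' x - U x) * p x := by
      have e₁ := mul_initial_of_star_mul_self (hp x) (h₁ x)
      have e₂ := final_mul_of_mul_star_self (hq x) (h₂ x)
      rw [mul_sub, sub_mul, e₂, e₁]
    rw [e]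
    calc ‖q x * (U' x - U x) * p x‖ ≤ ‖q x‖ * ‖U' x - U x‖ * ‖p x‖ := norm_mul₃_le
      _ ≤ 1 * (sqrtRadius B / 4) * 1 := by
        gcongr
        exacts [(hq x).norm_le, (hU' x).le, (hp x).norm_le]
      _ = _ := by ring
  have hZn : ∀ x, ‖Z x‖ ≤ 2 := fun x => by
    have := norm_add_le (Z x - U x) (U x)
    rw [sub_add_cancel] at this
    linarith [hZU x, hUn x]
  have hZp : ∀ x, ‖star (Z x) * Z x - p x‖ < sqrtRadius B := fun x => by
    have := norm_star_mul_self_sub_le_of_norm_le_one (hZn x) (hUn x)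
    rw [h₁] at this
    linarith [hZU x]
  have hZq : ∀ x, ‖Z x * star (Z x) - q x‖ < sqrtRadius B := fun x => by
    have := norm_star_mul_self_sub_le_of_norm_le_one (z := star (Z x)) (u := star (U x))
      (by rw [norm_star]; exact hZn x) (by rw [norm_star]; exact hUn x)
    rw [star_star, star_star, h₂, ← star_sub, norm_star] at this
    linarith [hZU x]
  have h := fun x => polar_spec_of_norm_lt (hp x) (hq x) (z := Z x)
    (by rw [hZ]; simp only; rw [mul_assoc, (hp x).isIdempotentElem.eq])
    (by rw [hZ]; simp only; rw [← mul_assoc, ← mul_assoc, (hq x).isIdempotentElem.eq])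
    ((hZp x).trans_le hr1) ((hZq x).trans_le hr1)
  refine ⟨fun x => polar (Z x) (p x), ?_, fun x => (h x).1, fun x => (h x).2⟩
  rw [← contMDiffOn_univ]
  exact contMDiffOn_polar (contMDiffOn_mul' (contMDiffOn_mul' hqs.contMDiffOn hU's.contMDiffOn)
    hps.contMDiffOn) hps.contMDiffOn (fun x _ => hp x) fun x _ => hZp x

end PartialIsometries

namespace HilbertModule

variable {A : Type u} [CStarAlgebra A] [PartialOrder A] [StarOrderedRing A] {n : ℕ}
  {M : CStarMatrix (Fin n) (Fin n) A}

theorem matrixAct_one_sub (M : CStarMatrix (Fin n) (Fin n) A) (v : std A n) :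
    matrixAct (1 - M) v = v - matrixAct M v := by
  rw [eq_sub_iff_add_eq, ← matrixAct_add, sub_add_cancel, matrixAct_one]

theorem mem_projImage (hM : IsStarProjection M) {v : std A n} :
    v ∈ projImage M hM ↔ matrixAct M v = v := by
  constructor
  · rintro ⟨u, rfl⟩
    rw [← matrixAct_mul, hM.isIdempotentElem.eq]
  · exact fun h => ⟨v, h⟩

theorem matrixAct_inclusion (hM : IsStarProjection M)
    (v : (std A n).ofClosedSubmodule (projImage M hM)) :
    matrixAct M ((std A n).inclusion _ v) = (std A n).inclusion _ v :=
  (mem_projImage hM).1 v.2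

theorem ip_inclusion_left (hM : IsStarProjection M)
    (v : (std A n).ofClosedSubmodule (projImage M hM)) (a : std A n) :
    (std A n).ip ((std A n).inclusion _ v) a = (std A n).ip ((std A n).inclusion _ v)
      (matrixAct M a) := by
  have h := ip_matrixAct M ((std A n).inclusion _ v) a
  rwa [hM.isSelfAdjoint.star_eq, matrixAct_inclusion hM] at h

theorem orthogonal_projImage (hM : IsStarProjection M) :
    (std A n).orthogonal (projImage M hM) = projImage (1 - M) hM.one_sub := by
  ext v
  have h : v ∈ (std A n).orthogonal (projImage M hM) ↔
      ∀ w ∈ projImage M hM, (std A n).ip w v = 0 := Iff.rfl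
  refine h.trans ((mem_projImage hM.one_sub).trans ?_).symm
  rw [matrixAct_one_sub, sub_eq_self]
  constructor
  · intro hv w hw
    rw [← (mem_projImage hM).1 hw, ip_matrixAct, hM.isSelfAdjoint.star_eq, hv, ip_zero_right]
  · intro hv
    refine (std A n).ip_ext fun z => ?_
    rw [ip_zero_left, ← star_ip, ← hM.isSelfAdjoint.star_eq, ← ip_matrixAct, hv _ ⟨z, rfl⟩,
      star_zero]

/-- The decomposition of `Aⁿ` as the sum of the images of two complementary projections. -/
noncomputable def sumIso (hM : IsStarProjection M) :
    IsometricIso (((std A n).ofClosedSubmodule (projImage M hM)).prod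
      ((std A n).ofClosedSubmodule (projImage (1 - M) hM.one_sub))) (std A n) where
  toLinearEquiv :=
    { toFun := fun z => (std A n).inclusion _ (prodFst _ _ z) + (std A n).inclusion _ (prodSnd _ _ z)
      invFun := fun a => prodMk _ _ (⟨matrixAct M a, a, rfl⟩ : LinearMap.range (matrixAct M))
        (⟨matrixAct (1 - M) a, a, rfl⟩ : LinearMap.range (matrixAct (1 - M)))
      map_add' := fun z z' => add_add_add_comm _ _ _ _
      map_smul' := fun c z => (smul_add c _ _).symm
      left_inv := fun z => by
        have h₁ := matrixAct_inclusion hM (prodFst _ _ z)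
        have h₂ := matrixAct_inclusion hM.one_sub (prodSnd _ _ z)
        have h₃ : matrixAct M ((std A n).inclusion _ (prodSnd _ _ z)) = 0 := by
          rw [← h₂, ← matrixAct_mul, mul_sub, mul_one, hM.isIdempotentElem.eq, sub_self]
          rw [← sub_self (1 : CStarMatrix (Fin n) (Fin n) A), matrixAct_one_sub, matrixAct_one,
            sub_self]
        refine congrArg₂ (prodMk _ _) (Subtype.ext ?_) (Subtype.ext ?_)
        · change matrixAct M (_ + _) = _
          rw [map_add, h₁, h₃, add_zero]
          rfl
        · change matrixAct (1 - M) (_ + _) = _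
          rw [map_add, h₂, matrixAct_one_sub, h₁, sub_self, zero_add]
          rfl
      right_inv := fun a => by
        change matrixAct M a + matrixAct (1 - M) a = a
        rw [matrixAct_one_sub, add_sub_cancel] }
  ip_map z z' := by
    have h₁ := matrixAct_inclusion hM (prodFst _ _ z)
    have h₁' := matrixAct_inclusion hM (prodFst _ _ z')
    have h₂ := matrixAct_inclusion hM.one_sub (prodSnd _ _ z)
    have h₂' := matrixAct_inclusion hM.one_sub (prodSnd _ _ z')
    have h0 : ∀ a b : std A n, (std A n).ip (matrixAct M a) (matrixAct (1 - M) b) = 0 := fun a b => by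
      have := orthogonal_projImage hM ▸
        (show matrixAct (1 - M) b ∈ projImage (1 - M) hM.one_sub from ⟨b, rfl⟩)
      exact this _ ⟨a, rfl⟩
    change (std A n).ip ((std A n).inclusion _ (prodFst _ _ z) + (std A n).inclusion _ (prodSnd _ _ z))
      ((std A n).inclusion _ (prodFst _ _ z') + (std A n).inclusion _ (prodSnd _ _ z')) =
      (std A n).ip ((std A n).inclusion _ (prodFst _ _ z)) ((std A n).inclusion _ (prodFst _ _ z')) +
      (std A n).ip ((std A n).inclusion _ (prodSnd _ _ z)) ((std A n).inclusion _ (prodSnd _ _ z'))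
    have e₁ : (std A n).ip ((std A n).inclusion _ (prodFst _ _ z))
        ((std A n).inclusion _ (prodSnd _ _ z')) = 0 := by rw [← h₁, ← h₂', h0]
    have e₂ : (std A n).ip ((std A n).inclusion _ (prodSnd _ _ z))
        ((std A n).inclusion _ (prodFst _ _ z')) = 0 := by
      rw [← star_ip, ← h₁', ← h₂, h0, star_zero]
    rw [ip_add_left, ip_add_right, ip_add_right, e₁, e₂, zero_add, add_zero]

theorem isFGP_projImage (hM : IsStarProjection M) :
    ((std A n).ofClosedSubmodule (projImage M hM)).IsFGP := ⟨n, _, ⟨sumIso hM⟩⟩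

end HilbertModule

namespace ProjectionFunction

open HilbertModule HilbertModuleFamily

variable {A : Type u} [CStarAlgebra A] [PartialOrder A] [StarOrderedRing A] {X : Type v}
  [TopologicalSpace X] {n : ℕ} (ε : ProjectionFunction A X n)

theorem ip_incl (x : X) (v : ε.image.fiber x) (a : std A n) :
    (std A n).ip (ε.incl x v) a = (ε.image.fiber x).ip v (ε.toImage x a) :=
  ip_inclusion_left (ε.isStarProjection x) v a

theorem ip_toImage (x : X) (a : std A n) (v : ε.image.fiber x) :
    (ε.image.fiber x).ip (ε.toImage x a) v = (std A n).ip a (ε.incl x v) :=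
  ((ε.image.fiber x).star_ip _ _).symm.trans
    ((congrArg star (ε.ip_incl x v a)).symm.trans ((std A n).star_ip _ _))

/-- The image of a projection valued function, embedded in the trivial bundle. -/
noncomputable def naturalFrame : ε.image.Frame n where
  J x := Hom.ofAdjoint (ε.incl x) (ε.toImage x) (ε.ip_incl x)
  K x := Hom.ofAdjoint (ε.toImage x) (ε.incl x) (ε.ip_toImage x)
  ip_J := ε.ip_incl
  K_J x v := Subtype.ext (matrixAct_inclusion (ε.isStarProjection x) v)
  continuous_J :=
    have h₁ : Continuous fun q : ε.image.Total =>
      (⟨q.base, ε.incl q.base q.vec⟩ : (ambient A X n).Total) := continuous_induced_dom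
    have h₂ : Continuous fun q : (ambient A X n).Total => ((q.base, q.vec) : X × std A n) :=
      continuous_induced_dom
    h₂.comp h₁
  continuous_K := continuous_induced_rng.2 (continuous_induced_rng.2
    (continuous_fst.prodMk (continuous_matrixAct_uncurry.comp
      ((ε.continuous_toFun.comp continuous_fst).prodMk continuous_snd))))

theorem gramMatrix_naturalFrame (x : X) : ε.naturalFrame.gramMatrix x = ε.toFun x :=
  matrixAct_injective fun v => by rw [Frame.gramMatrix_act]; rfl

theorem isFGPBundle_image : ε.image.IsFGPBundle :=
  ⟨ε.naturalFrame.isBundle, fun x => isFGP_projImage (ε.isStarProjection x)⟩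

/-- The complementary projection valued function. -/
noncomputable def compl : ProjectionFunction A X n where
  toFun x := 1 - ε.toFun x
  continuous_toFun := continuous_const.sub ε.continuous_toFun
  isStarProjection x := (ε.isStarProjection x).one_sub

/-- The sum decomposition of the trivial bundle. -/
noncomputable def sumIso :
    HilbertModuleFamily.Iso (ε.image.directSum ε.compl.image) (ambient A X n) where
  fiberEquiv x := (HilbertModule.sumIso (ε.isStarProjection x)).toLinearEquiv
  adjointable x := ⟨_, (HilbertModule.sumIso (ε.isStarProjection x)).ip_apply_left⟩
  continuous_toFun := by
    have h : Continuous fun q : (ε.image.directSum ε.compl.image).Total =>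
        ((⟨q.base, prodFst _ _ q.vec⟩, ⟨q.base, prodSnd _ _ q.vec⟩) :
          ε.image.Total × ε.compl.image.Total) := continuous_induced_dom
    have h₁ := ε.naturalFrame.continuous_J.comp (continuous_fst.comp h)
    have h₂ := ε.compl.naturalFrame.continuous_J.comp (continuous_snd.comp h)
    exact continuous_induced_rng.2 ((continuous_fst.comp h₁).prodMk
      ((continuous_snd.comp h₁).add (continuous_snd.comp h₂)))
  continuous_invFun := by
    have h : Continuous fun q : (ambient A X n).Total => ((q.base, q.vec) : X × std A n) :=
      continuous_induced_dom
    exact continuous_induced_rng.2 ((ε.naturalFrame.continuous_K.comp h).prodMk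
      (ε.compl.naturalFrame.continuous_K.comp h))

theorem isOrthogonalSummand : (ambient A X n).IsOrthogonalSummand
    fun x => projImage (ε.toFun x) (ε.isStarProjection x) := by
  have key : ∀ p' : X → ClosedSubmodule Aᵐᵒᵖ (std A n),
      (p' = fun x => projImage (ε.compl.toFun x) (ε.compl.isStarProjection x)) →
      ((ambient A X n).sub p').IsFGPBundle ∧
      ∃ Ψ : HilbertModuleFamily.Iso (ε.image.directSum ((ambient A X n).sub p')) (ambient A X n),
        Ψ.IsIsometric ∧ ∀ (x : X) (v : ε.image.fiber x) (v' : (std A n).ofClosedSubmodule (p' x)),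
          Ψ.fiberEquiv x (HilbertModule.prodMk _ _ v v') =
            (std A n).inclusion _ v + (std A n).inclusion _ v' := by
    rintro _ rfl
    exact ⟨ε.compl.isFGPBundle_image, ε.sumIso,
      fun x => (HilbertModule.sumIso (ε.isStarProjection x)).ip_map, fun _ _ _ => rfl⟩
  exact ⟨ε.isFGPBundle_image, key _ (funext fun x => orthogonal_projImage (ε.isStarProjection x))⟩

theorem exists_isometric_iso_of_norm_sub_lt {ε₁ ε₂ : ProjectionFunction A X n}
    (h : ∀ x, ‖ε₁.toFun x - ε₂.toFun x‖ < 1) :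
    ∃ Φ : HilbertModuleFamily.Iso ε₁.image ε₂.image, Φ.IsIsometric := by
  have hU : Continuous fun x => align (ε₁.toFun x) (ε₂.toFun x) := by
    rw [← continuousOn_univ]
    exact continuousOn_align ε₁.continuous_toFun.continuousOn ε₂.continuous_toFun.continuousOn
      (fun x _ => ε₁.isStarProjection x) (fun x _ => ε₂.isStarProjection x) fun x _ => h x
  have hs := fun x => align_spec (ε₁.isStarProjection x) (ε₂.isStarProjection x) (h x)
  exact ⟨_, ε₁.naturalFrame.iso_isIsometric ε₂.naturalFrame hU
    (fun x => (hs x).1.trans (ε₁.gramMatrix_naturalFrame x).symm)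
    fun x => (hs x).2.trans (ε₂.gramMatrix_naturalFrame x).symm⟩

section Smooth

variable {E : Type*} [NormedAddCommGroup E] [NormedSpace ℝ E] {H : Type*} [TopologicalSpace H]
  {I : ModelWithCorners ℝ E H} [ChartedSpace H X]

theorem exists_isInherited
    (h : ContMDiff I 𝓘(ℝ, CStarMatrix (Fin n) (Fin n) A) ∞ ε.toFun) :
    ∃ S : ε.image.SmoothStructure I, ε.IsInherited S :=
  ⟨_, ε.naturalFrame.isSmooth_smoothStructure
    (by rwa [funext ε.gramMatrix_naturalFrame])⟩

theorem IsInherited.isSmoothMap_id {ε : ProjectionFunction A X n}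
    {S S' : ε.image.SmoothStructure I} (h : ε.IsInherited S) (h' : ε.IsInherited S') :
    IsSmoothMap S S' fun _ v => v := by
  have := h'.2.comp h.1
  have e : (fun (x : X) (v : ε.image.fiber x) => ε.toImage x (ε.incl x v)) = fun _ v => v :=
    funext fun x => funext fun v => ε.naturalFrame.K_J x v
  rwa [e] at this

theorem IsInherited.equivalent {ε : ProjectionFunction A X n}
    {S S' : ε.image.SmoothStructure I} (h : ε.IsInherited S) (h' : ε.IsInherited S') :
    S.Equivalent S' := ⟨h.isSmoothMap_id h', h'.isSmoothMap_id h⟩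

end Smooth

end ProjectionFunction

namespace HilbertModuleFamily

open HilbertModule

variable {A : Type u} [CStarAlgebra A] [PartialOrder A] [StarOrderedRing A] {X : Type v}
  [TopologicalSpace X] {n : ℕ}

namespace Frame

variable {W : HilbertModuleFamily.{u, v, w} A X} (F : W.Frame n)

theorem star_gramMatrix_mul_self (x : X) :
    star (F.gramMatrix x) * F.gramMatrix x = F.gramMatrix x := by
  rw [(F.isStarProjection_gramMatrix x).isSelfAdjoint.star_eq,
    (F.isStarProjection_gramMatrix x).isIdempotentElem.eq]

theorem gramMatrix_mul_star_self (x : X) :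
    F.gramMatrix x * star (F.gramMatrix x) = F.gram.naturalFrame.gramMatrix x := by
  rw [F.gram.gramMatrix_naturalFrame, (F.isStarProjection_gramMatrix x).isSelfAdjoint.star_eq,
    (F.isStarProjection_gramMatrix x).isIdempotentElem.eq]
  rfl

/-- A bundle is isomorphic to the image of the Gram matrix of a frame. -/
noncomputable def isoImage : Iso W F.gram.image :=
  F.iso F.gram.naturalFrame F.continuous_gramMatrix F.star_gramMatrix_mul_self
    F.gramMatrix_mul_star_self

theorem isIsometric_isoImage : F.isoImage.IsIsometric := F.iso_isIsometric _ _ _ _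

variable {E : Type*} [NormedAddCommGroup E] [NormedSpace ℝ E]
  {H : Type*} [TopologicalSpace H] {I : ModelWithCorners ℝ E H} [ChartedSpace H X]

theorem IsSmooth.isSmooth_isoImage {F : W.Frame n} {S : W.SmoothStructure I} (hF : F.IsSmooth S)
    {S' : F.gram.image.SmoothStructure I} (hS' : F.gram.IsInherited S') :
    F.isoImage.IsSmooth S S' :=
  isSmooth_iso hF (F₂ := F.gram.naturalFrame) hS' hF.contMDiff_gramMatrix
    F.star_gramMatrix_mul_self F.gramMatrix_mul_star_self

variable [FiniteDimensional ℝ E] [IsManifold I ∞ X] [CompactSpace X] [T2Space X]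

theorem nonempty_smoothStructure (F : W.Frame n) : Nonempty (W.SmoothStructure I) := by
  obtain ⟨p, hps, hp, hpF⟩ := exists_contMDiff_isStarProjection I F.continuous_gramMatrix
    F.isStarProjection_gramMatrix one_pos
  have h : ∀ x, ‖F.gramMatrix x - p x‖ < 1 := fun x => by rw [norm_sub_rev]; exact hpF x
  have hU : Continuous fun x => align (F.gramMatrix x) (p x) := by
    rw [← continuousOn_univ]
    exact continuousOn_align F.continuous_gramMatrix.continuousOn hps.continuous.continuousOn
      (fun x _ => F.isStarProjection_gramMatrix x) (fun x _ => hp x) fun x _ => h x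
  have hs := fun x => align_spec (F.isStarProjection_gramMatrix x) (hp x) (h x)
  refine ⟨(F.transport hU fun x => (hs x).1).smoothStructure ?_⟩
  have : (F.transport hU fun x => (hs x).1).gramMatrix = p := funext fun x =>
    (F.gramMatrix_transport hU (fun x => (hs x).1) x).trans (hs x).2
  rwa [this]

end Frame

theorem Iso.continuous_fiberEquiv_comp {W₁ : HilbertModuleFamily.{u, v, w} A X}
    {W₂ : HilbertModuleFamily.{u, v, w'} A X} (Φ : Iso W₁ W₂) (F₁ : W₁.Frame n) (F₂ : W₂.Frame n) :
    Continuous (fun x => toMat fun a => (F₂.J x).1 (Φ.fiberEquiv x ((F₁.K x).1 a))) ∧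
    Continuous (fun x => toMat fun a => (F₁.J x).1 ((Φ.fiberEquiv x).symm ((F₂.K x).1 a))) :=
  ⟨continuous_toMat fun _ => continuous_snd.comp (F₂.continuous_J.comp (Φ.continuous_toFun.comp
      (F₁.continuous_K.comp (continuous_id.prodMk continuous_const)))),
    continuous_toMat fun _ => continuous_snd.comp (F₁.continuous_J.comp (Φ.continuous_invFun.comp
      (F₂.continuous_K.comp (continuous_id.prodMk continuous_const))))⟩

/-- The matrix of a linear map between fibers with respect to two frames. -/
theorem matrixAct_toMat_frame {W₁ : HilbertModuleFamily.{u, v, w} A X}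
    {W₂ : HilbertModuleFamily.{u, v, w'} A X} (F₁ : W₁.Frame n) (F₂ : W₂.Frame n) {x : X}
    (L : W₁.fiber x →ₗ[Aᵐᵒᵖ] W₂.fiber x) (a : std A n) :
    matrixAct (toMat fun a => (F₂.J x).1 (L ((F₁.K x).1 a))) a =
      (F₂.J x).1 (L ((F₁.K x).1 a)) :=
  matrixAct_toMat
    { toFun := fun a => (F₂.J x).1 (L ((F₁.K x).1 a))
      map_add' := fun a b => by rw [map_add, map_add, map_add]
      map_smul' := fun c a => by
        rw [Hom.map_op_smul, map_smul, Hom.map_op_smul, RingHom.id_apply] } a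

/-- The unitary part of an isomorphism, as a function with values in the partial isometries between
the Gram matrices of two frames. -/
theorem Iso.exists_continuous_partialIsometry {W₁ : HilbertModuleFamily.{u, v, w} A X}
    {W₂ : HilbertModuleFamily.{u, v, w'} A X} (Φ : Iso W₁ W₂) (F₁ : W₁.Frame n) (F₂ : W₂.Frame n) :
    ∃ U : X → CStarMatrix (Fin n) (Fin n) A, Continuous U ∧
      (∀ x, star (U x) * U x = F₁.gramMatrix x) ∧ ∀ x, U x * star (U x) = F₂.gramMatrix x := by
  obtain ⟨hT, hT'⟩ := Φ.continuous_fiberEquiv_comp F₁ F₂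
  have e := fun x => matrixAct_toMat_frame F₁ F₂ (Φ.fiberEquiv x).toLinearMap
  have e' := fun x => matrixAct_toMat_frame F₂ F₁ (Φ.fiberEquiv x).symm.toLinearMap
  simp only [LinearEquiv.coe_coe] at e e'
  refine _root_.exists_continuous_partialIsometry hT F₁.continuous_gramMatrix
    F₁.isStarProjection_gramMatrix F₂.isStarProjection_gramMatrix (t' := fun x => toMat fun a =>
      (F₁.J x).1 ((Φ.fiberEquiv x).symm ((F₂.K x).1 a))) ?_ ?_ ?_ ?_ ?_ ?_ <;>
    refine fun x => matrixAct_injective fun a => ?_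
  · rw [matrixAct_mul, e, F₁.K_gramMatrix_act, e]
  · rw [matrixAct_mul, e, F₂.gramMatrix_act_J]
  · rw [matrixAct_mul, e', F₁.gramMatrix_act_J]
  · rw [matrixAct_mul, e', F₂.K_gramMatrix_act, e']
  · rw [matrixAct_mul, e, e', F₂.K_J, LinearEquiv.symm_apply_apply, F₁.gramMatrix_act]
  · rw [matrixAct_mul, e', e, F₁.K_J, LinearEquiv.apply_symm_apply, F₂.gramMatrix_act]

theorem exists_isometric_isSmooth_iso {E : Type*} [NormedAddCommGroup E] [NormedSpace ℝ E]
    [FiniteDimensional ℝ E] {H : Type*} [TopologicalSpace H] {I : ModelWithCorners ℝ E H}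
    [ChartedSpace H X] [IsManifold I ∞ X] [CompactSpace X] [T2Space X]
    {W₁ : HilbertModuleFamily.{u, v, w} A X} {W₂ : HilbertModuleFamily.{u, v, w'} A X}
    {S₁ : W₁.SmoothStructure I} {S₂ : W₂.SmoothStructure I} (hW₁ : W₁.IsFGPBundle)
    (hW₂ : W₂.IsFGPBundle) (Φ : Iso W₁ W₂) :
    ∃ Ψ : Iso W₁ W₂, Ψ.IsIsometric ∧ Ψ.IsSmooth S₁ S₂ := by
  obtain ⟨N₁, h₁⟩ := hW₁.exists_isSmooth_frame S₁
  obtain ⟨N₂, h₂⟩ := hW₂.exists_isSmooth_frame S₂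
  obtain ⟨F₁, hF₁⟩ := h₁ (max N₁ N₂) (le_max_left _ _)
  obtain ⟨F₂, hF₂⟩ := h₂ (max N₁ N₂) (le_max_right _ _)
  obtain ⟨U, hU, hU₁, hU₂⟩ := Φ.exists_continuous_partialIsometry F₁ F₂
  obtain ⟨V, hV, hV₁, hV₂⟩ := exists_contMDiff_partialIsometry I hF₁.contMDiff_gramMatrix
    hF₂.contMDiff_gramMatrix F₁.isStarProjection_gramMatrix F₂.isStarProjection_gramMatrix
    hU hU₁ hU₂
  exact ⟨F₁.iso F₂ hV.continuous hV₁ hV₂, F₁.iso_isIsometric F₂ hV.continuous hV₁ hV₂,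
    Frame.isSmooth_iso hF₁ hF₂ hV hV₁ hV₂⟩

end HilbertModuleFamily

theorem mainTheorem10 {A : Type u} [CStarAlgebra A] [PartialOrder A] [StarOrderedRing A]
    {X : Type v} [TopologicalSpace X] [CompactSpace X] [T2Space X] :
    -- W is isometrically an orthogonal direct summand of a trivial bundle
    (∀ W : HilbertModuleFamily.{u, v, w} A X, W.IsFGPBundle →
      ∃ (n : ℕ) (p : X → ClosedSubmodule Aᵐᵒᵖ (HilbertModule.std A n)),
        (HilbertModuleFamily.trivial X (HilbertModule.std A n)).IsOrthogonalSummand p ∧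
        ∃ Φ : HilbertModuleFamily.Iso W
            ((HilbertModuleFamily.trivial X (HilbertModule.std A n)).sub p), Φ.IsIsometric) ∧
    -- W is isometrically the image of a projection valued function
    (∀ W : HilbertModuleFamily.{u, v, w} A X, W.IsFGPBundle →
      ∃ (n : ℕ) (ε : ProjectionFunction A X n),
        ∃ Φ : HilbertModuleFamily.Iso W ε.image, Φ.IsIsometric) ∧
    -- images of projection valued functions are bundles
    (∀ (n : ℕ) (ε : ProjectionFunction A X n), ε.image.IsFGPBundle) ∧
    -- nearby projection valued functions have isomorphic images
    (∀ (n : ℕ) (ε₁ : ProjectionFunction A X n), ∃ δ : ℝ, 0 < δ ∧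
      ∀ ε₂ : ProjectionFunction A X n, (∀ x, ‖ε₁.toFun x - ε₂.toFun x‖ < δ) →
        ∃ Φ : HilbertModuleFamily.Iso ε₁.image ε₂.image, Φ.IsIsometric) ∧
    -- the smooth statements, if X is a smooth manifold
    (∀ {E : Type uE} [NormedAddCommGroup E] [NormedSpace ℝ E] [FiniteDimensional ℝ E]
      {H : Type uH} [TopologicalSpace H] (I : ModelWithCorners ℝ E H) [ChartedSpace H X]
      [IsManifold I ∞ X],
      -- the image of a smooth projection valued function has a canonical smooth structure
      (∀ (n : ℕ) (ε : ProjectionFunction A X n),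
        ContMDiff I 𝓘(ℝ, CStarMatrix (Fin n) (Fin n) A) ∞ ε.toFun →
        ∃ S : ε.image.SmoothStructure I, ε.IsInherited S ∧
          ∀ S' : ε.image.SmoothStructure I, ε.IsInherited S' → S'.Equivalent S) ∧
      -- a smooth bundle is smoothly isomorphic to the image of a smooth projection valued function
      (∀ (W : HilbertModuleFamily.{u, v, w} A X) (S : W.SmoothStructure I), W.IsFGPBundle →
        ∃ (n : ℕ) (ε : ProjectionFunction A X n),
          ContMDiff I 𝓘(ℝ, CStarMatrix (Fin n) (Fin n) A) ∞ ε.toFun ∧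
          ∃ S' : ε.image.SmoothStructure I, ε.IsInherited S' ∧
            ∃ Φ : HilbertModuleFamily.Iso W ε.image, Φ.IsIsometric ∧ Φ.IsSmooth S S') ∧
      -- existence of smooth structures
      (∀ W : HilbertModuleFamily.{u, v, w} A X, W.IsFGPBundle →
        Nonempty (W.SmoothStructure I)) ∧
      -- uniqueness: topologically isomorphic smooth bundles are smoothly isomorphic
      (∀ (W₁ : HilbertModuleFamily.{u, v, w} A X) (W₂ : HilbertModuleFamily.{u, v, w'} A X)
        (S₁ : W₁.SmoothStructure I) (S₂ : W₂.SmoothStructure I),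
        W₁.IsFGPBundle → W₂.IsFGPBundle → Nonempty (HilbertModuleFamily.Iso W₁ W₂) →
        ∃ Φ : HilbertModuleFamily.Iso W₁ W₂, Φ.IsIsometric ∧ Φ.IsSmooth S₁ S₂)) := by
  refine ⟨fun W hW => ?_, fun W hW => ?_, fun n ε => ε.isFGPBundle_image, fun n ε₁ => ?_,
    fun I _ _ => ⟨fun n ε hε => ?_, fun W S hW => ?_, fun W hW => ?_,
      fun W₁ W₂ S₁ S₂ hW₁ hW₂ ⟨Φ⟩ =>
        HilbertModuleFamily.exists_isometric_isSmooth_iso hW₁ hW₂ Φ⟩⟩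
  · obtain ⟨N, hN⟩ := hW.exists_frame
    obtain ⟨F⟩ := hN N le_rfl
    exact ⟨N, _, F.gram.isOrthogonalSummand, F.isoImage, F.isIsometric_isoImage⟩
  · obtain ⟨N, hN⟩ := hW.exists_frame
    obtain ⟨F⟩ := hN N le_rfl
    exact ⟨N, F.gram, F.isoImage, F.isIsometric_isoImage⟩
  · exact ⟨1, one_pos, fun ε₂ h => ProjectionFunction.exists_isometric_iso_of_norm_sub_lt h⟩
  · obtain ⟨S, hS⟩ := ε.exists_isInherited hε
    exact ⟨S, hS, fun S' hS' => hS'.equivalent hS⟩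
  · obtain ⟨N, hN⟩ := hW.exists_isSmooth_frame S
    obtain ⟨F, hF⟩ := hN N le_rfl
    obtain ⟨S', hS'⟩ := F.gram.exists_isInherited hF.contMDiff_gramMatrix
    exact ⟨N, F.gram, hF.contMDiff_gramMatrix, S', hS', F.isoImage, F.isIsometric_isoImage,
      hF.isSmooth_isoImage hS'⟩
  · obtain ⟨N, hN⟩ := hW.exists_frame
    obtain ⟨F⟩ := hN N le_rfl
    exact F.nonempty_smoothStructure
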